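/- Consider $N$ double-integrator agents $\dot x_i=v_i$, $\dot v_i=b_iu_i$ ($i=1,\dots,N$) with unknown constants $b_i\neq0$ of possibly different signs. Let $\mathcal G_1,\dots,\mathcal G_M$ be weighted directed graphs on $\{1,\dots,N\}$ with nonnegative adjacency matrices $A_1,\dots,A_M$ (an edge $k\to i$ is present in $\mathcal G_\ell$ iff $(A_\ell)_{ik}>0$) and Laplacians $L_\ell=D_\ell-A_\ell$, where $D_\ell$ is the diagonal matrix of the row sums of $A_\ell$. A basis bicomponent of a directed graph is a (nonempty) strongly connected subgraph without incoming links from other nodes. Assume: (i) the graphs $\mathcal G_\ell$ have a jointly strongly connected basis: the union of all basis bicomponents of all $\mathcal G_\ell$ is a strongly connected graph having all of $\{1,\dots,N\}$ as vertices; (ii) there are switching times $0=t_1<t_2<\cdots$ with $t_{j+1}-t_j>\tau_{\min}$ for all $j$ and some $\tau_{\min}>0$, and a map $\bar n:\mathbb N_+\to\{1,\dots,M\}$, such that the adjacency matrix $(a_{ik}(t))$ in use at time $t$ is $A_{\bar n(j)}$ for $t\in[t_j,t_{j+1})$; (iii) for each $\ell$ there are a constant $\tau_{\max}>0$ and sequences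 $T^a_{\ell\nu},T^d_{\ell\nu}\in\{t_j\}$ ($\nu\ge1$) with $T^a_{\ell\nu}<T^d_{\ell\nu}\le T^a_{\ell,\nu+1}\le T^d_{\ell\nu}+\tau_{\max}$, such that the Laplacian of $(a_{ik}(t))$ is $L_\ell$ on $[T^a_{\ell\nu},T^d_{\ell\nu})$ for all $\nu$. Let $\rho,\lambda_1,\lambda_2>0$ and put $\zeta_i=\sum_k a_{ik}(v_i-v_k)$, $\eta_i=\sum_k a_{ik}(x_i-x_k)$, $q_i=v_i+\rho x_i$, $r_i=\zeta_i+\rho\eta_i$, $$R_i(t)=\tfrac12q_i^2(t)+\tfrac\rho2x_i^2(t)+\lambda_1\int_0^tq_i^2r_i^2\,ds+\int_0^tv_i^2\,ds+\tfrac{\lambda_2}2\Big[\int_0^tq_ir_i\,ds\Big]^2,$$ $$u_i(t)=R_i(t)\cos(R_i(t))\Big[(\rho+1)v_i(t)+r_i(t)\Big(\lambda_1q_i(t)r_i(t)+\lambda_2\int_0^tq_ir_i\,ds\Big)\Big].$$ A solution of the closed loop is a pair of continuous functions $(x,v)$ that satisfies the differential equations at all times other than the $t_j$. Then for every initial value $(x(0),v(0))$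 the closed loop has a solution on $[0,\infty)$, any two solutions on an interval $[0,T)$ with the same initial value coincide there, and for every solution on $[0,\infty)$: all $x_i,v_i,u_i$ are bounded on $[0,\infty)$; $x_i(t)-x_k(t)\to0$ and $v_i(t)-v_k(t)\to0$ as $t\to\infty$ for all $i,k$; and in fact $v_i(t)\to0$ for all $i$. -/

import Mathlib

open Filter Topology Set

namespace ConsensusPI

noncomputable section

/-- The directed graph with edge `k → i` exactly when the coupling strength `A i k` is positive. -/
def graphOf {N : ℕ} (A : Matrix (Fin N) (Fin N) ℝ) : Digraph (Fin N) where
  Adj k i := 0 < A i k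

/-- The Laplacian `D - A`, where `D` is the diagonal matrix of the in-degrees `∑ k, A i k`. -/
def laplacian {N : ℕ} (A : Matrix (Fin N) (Fin N) ℝ) : Matrix (Fin N) (Fin N) ℝ :=
  Matrix.diagonal (fun i => ∑ k, A i k) - A

/-- A directed graph is strongly connected if a directed path joins any node to any other. -/
def StronglyConnected {V : Type*} (G : Digraph V) : Prop :=
  ∀ i j : V, i ≠ j → Relation.TransGen G.Adj i j

/-- `S` is the vertex set of a basis bicomponent of `G`: the subgraph of `G` on `S` is nonempty
and strongly connected, and no link of `G` enters `S` from a node outside `S`.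
A single node without incoming links from other nodes is a basis bicomponent. -/
def IsBasisBicomponent {V : Type*} (G : Digraph V) (S : Set V) : Prop :=
  S.Nonempty ∧
  StronglyConnected (V := S) ⟨fun k i => G.Adj k i⟩ ∧
  ∀ k i : V, i ∈ S → G.Adj k i → k ∈ S

/-- The union of all basis bicomponents of all the graphs of a group (its edges). -/
def basisUnion {V ι : Type*} (G : ι → Digraph V) : Digraph V where
  Adj k i := ∃ (l : ι) (S : Set V),
    IsBasisBicomponent (G l) S ∧ k ∈ S ∧ i ∈ S ∧ (G l).Adj k i

/-- The union of all basis bicomponents of the graphs contains every node and is strongly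
connected. -/
def JointlyStronglyConnectedBasis {V ι : Type*} (G : ι → Digraph V) : Prop :=
  (∀ i : V, ∃ (l : ι) (S : Set V), IsBasisBicomponent (G l) S ∧ i ∈ S) ∧
  StronglyConnected (basisUnion G)

/-- The switching topologies: `A l` (`l : Fin M`) are the adjacency matrices of the available
topologies, `τ 0 = 0 < τ 1 < τ 2 < ⋯` the switching times, `n j` the index of the topology that is
used on `[τ j, τ (j+1))`, and `a t` the adjacency matrix at time `t ≥ 0`. -/
structure SwitchingTopology {N M : ℕ} (A : Fin M → Matrix (Fin N) (Fin N) ℝ)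
    (τ : ℕ → ℝ) (n : ℕ → Fin M) (a : ℝ → Matrix (Fin N) (Fin N) ℝ) : Prop where
  weights_nonneg : ∀ l i k, 0 ≤ A l i k
  start : τ 0 = 0
  dwell : ∃ τmin : ℝ, 0 < τmin ∧ ∀ j, τmin < τ (j + 1) - τ j
  active : ∀ j, ∀ t ∈ Ico (τ j) (τ (j + 1)), a t = A (n j)
  joint : JointlyStronglyConnectedBasis (fun l => graphOf (A l))
  /-- Every topology `l` is active on intervals `[Ta ν, Td ν)`, with gaps at most `τmax`
  between consecutive intervals. -/
  reactivation : ∀ l : Fin M, ∃ (Ta Td : ℕ → ℝ) (τmax : ℝ), 0 < τmax ∧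
    (∀ ν, Ta ν ∈ range τ ∧ Td ν ∈ range τ) ∧
    (∀ ν, Ta ν < Td ν ∧ Td ν ≤ Ta (ν + 1)) ∧
    (∀ ν, ∀ t ∈ Ico (Ta ν) (Td ν), laplacian (a t) = laplacian (A l)) ∧
    ∀ ν, Ta (ν + 1) - Td ν ≤ τmax

/-- The weighted disagreement `∑ k, a_{ik}(t) (y_i(t) - y_k(t))`: this is `ζ_i` for `y = v`
and `η_i` for `y = x`. -/
def disagreement {N : ℕ} (a : ℝ → Matrix (Fin N) (Fin N) ℝ) (y : Fin N → ℝ → ℝ)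
    (i : Fin N) (t : ℝ) : ℝ :=
  ∑ k, a t i k * (y i t - y k t)

/-- `q_i = v_i + ρ x_i`. -/
def q {N : ℕ} (ρ : ℝ) (x v : Fin N → ℝ → ℝ) (i : Fin N) (t : ℝ) : ℝ :=
  v i t + ρ * x i t

/-- `r_i = ζ_i + ρ η_i`. -/
def r {N : ℕ} (ρ : ℝ) (a : ℝ → Matrix (Fin N) (Fin N) ℝ) (x v : Fin N → ℝ → ℝ)
    (i : Fin N) (t : ℝ) : ℝ :=
  disagreement a v i t + ρ * disagreement a x i t

/-- The nonlinear PI function `R_i`. -/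
def R {N : ℕ} (ρ l₁ l₂ : ℝ) (a : ℝ → Matrix (Fin N) (Fin N) ℝ) (x v : Fin N → ℝ → ℝ)
    (i : Fin N) (t : ℝ) : ℝ :=
  1 / 2 * q ρ x v i t ^ 2 + ρ / 2 * x i t ^ 2
    + l₁ * (∫ s in (0 : ℝ)..t, q ρ x v i s ^ 2 * r ρ a x v i s ^ 2)
    + (∫ s in (0 : ℝ)..t, v i s ^ 2)
    + l₂ / 2 * (∫ s in (0 : ℝ)..t, q ρ x v i s * r ρ a x v i s) ^ 2

/-- The control input `u_i`. -/
def u {N : ℕ} (ρ l₁ l₂ : ℝ) (a : ℝ → Matrix (Fin N) (Fin N) ℝ) (x v : Fin N → ℝ → ℝ)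
    (i : Fin N) (t : ℝ) : ℝ :=
  R ρ l₁ l₂ a x v i t * Real.cos (R ρ l₁ l₂ a x v i t) *
    ((ρ + 1) * v i t + r ρ a x v i t *
      (l₁ * (q ρ x v i t * r ρ a x v i t)
        + l₂ * ∫ s in (0 : ℝ)..t, q ρ x v i s * r ρ a x v i s))

/-- `(x, v)` solves the closed-loop system `x_i' = v_i`, `v_i' = b_i u_i` on the time interval `J`
(of the form `[0, T)` or `[0, ∞)`): the states are continuous on `J`, and the differential
equations hold at all times of `J` other than the switching times `τ j`. -/
structure IsClosedLoopSolution {N : ℕ} (b : Fin N → ℝ) (ρ l₁ l₂ : ℝ) (τ : ℕ → ℝ)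
    (a : ℝ → Matrix (Fin N) (Fin N) ℝ) (J : Set ℝ) (x v : Fin N → ℝ → ℝ) : Prop where
  cont_x : ∀ i, ContinuousOn (x i) J
  cont_v : ∀ i, ContinuousOn (v i) J
  deriv_x : ∀ i, ∀ t ∈ J, t ∉ range τ → HasDerivAt (x i) (v i t) t
  deriv_v : ∀ i, ∀ t ∈ J, t ∉ range τ → HasDerivAt (v i) (b i * u ρ l₁ l₂ a x v i t) t

end

end ConsensusPI

/-! Two mechanisms combine: a barrier for each scalar `R_i`, and a maximum principle on basis
bicomponents.

Write `g_i` for the bracket in `u_i`. Differentiating gives `R_i' = q_i g_i (1 + b_i R_i cos R_i)`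
(`State.IsTrajectory.deriv_R`). Every zero `c` of `1 + b_i z cos z` is an equilibrium of this scalar
equation, so by uniqueness `R_i` cannot cross it (`le_of_barrier`); such zeros exist arbitrarily far
out whatever the sign of `b_i` (`exists_barrier`). Hence `R_i` stays below a constant that depends
only on its initial value. All summands of `R_i` are nonnegative, so the states, `∫ q_i² r_i²` and
`∫ v_i²` are bounded, and Barbalat's lemma between switches gives `q_i r_i → 0` and `v_i → 0`.

Since `r = L q`, the products `q_i (L q)_i` are small whenever a topology is active. If they vanish
on a basis bicomponent, a maximum principle makes `q` constant there; compactness makes this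
quantitative (`exists_pos_forall_abs_sub_lt`). As `v → 0`, positions barely move during the bounded
waiting time until the next activation, so position differences on each bicomponent tend to zero at
all times; joint strong connectivity chains them together.

For existence, the field of the augmented state (with the integrals as coordinates) is cut off by a
bump function. The a priori bound holds for any speed in `[0, 1]`, hence for the cut-off flow, which
therefore never reaches the region where the cutoff acts. -/

namespace ConsensusPI

/-! ### Global flows, the scalar barrier and monotonicity -/

/-- A compactly supported `C¹` vector field has integral curves on every compact time interval. -/
theorem exists_integralCurve_of_hasCompactSupport {E : Type*} [NormedAddCommGroup E]
    [NormedSpace ℝ E] [CompleteSpace E] {f : E → E} (hf : ContDiff ℝ 1 f)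
    (hc : HasCompactSupport f) (t₀ t₁ : ℝ) (y₀ : E) :
    ∃ α : ℝ → E, α t₀ = y₀ ∧ ∀ t ∈ Icc t₀ t₁, HasDerivAt α (f (α t)) t := by
  obtain ⟨K, hK⟩ := hf.lipschitzWith_of_hasCompactSupport hc one_ne_zero
  obtain ⟨B, hB⟩ := hc.exists_bound_of_continuous hf.continuous
  set L : NNReal := B.toNNReal
  have hL : ∀ y, ‖f y‖ ≤ L := fun y => (hB y).trans (Real.le_coe_toNNReal B)
  -- The extra unit of time on both sides puts `[t₀, t₁]` in the interior of the Picard–Lindelöf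
  -- interval, so the derivatives at its ends are two-sided.
  set T : NNReal := (1 + |t₁ - t₀|).toNNReal
  have hT : (T : ℝ) = 1 + |t₁ - t₀| := Real.coe_toNNReal _ (by positivity)
  have habs := le_abs_self (t₁ - t₀)
  have habs' := abs_nonneg (t₁ - t₀)
  have h0 : t₀ ∈ Icc (t₀ - 1) (t₀ + T) := ⟨by linarith, by rw [hT]; linarith⟩
  have hP : IsPicardLindelof (fun _ => f) (⟨t₀, h0⟩ : Icc (t₀ - 1) (t₀ + T)) y₀ (L * T) 0 L K := by
    refine IsPicardLindelof.of_time_independent (fun x _ => hL x) hK.lipschitzOnWith ?_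
    have : max (t₀ + T - t₀) (t₀ - (t₀ - 1)) = T := by
      rw [max_eq_left] <;> linarith
    simp only [this]
    simp
  obtain ⟨α, h1, h2⟩ := hP.exists_eq_forall_mem_Icc_hasDerivWithinAt₀
  refine ⟨α, h1, fun t ht => (h2 t ⟨?_, ?_⟩).hasDerivAt (Icc_mem_nhds ?_ ?_)⟩ <;>
  linarith [ht.1, ht.2]

/-- A solution of `z' = g (1 + b z cos z)` cannot cross a zero of `1 + b z cos z`. -/
theorem le_of_barrier {z g : ℝ → ℝ} {b T c G : ℝ} (hz : ContinuousOn z (Icc 0 T))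
    (hz' : ∀ t ∈ Ico 0 T, HasDerivWithinAt z (g t * (1 + b * z t * Real.cos (z t))) (Ici t) t)
    (hg : ∀ t ∈ Ico 0 T, |g t| ≤ G) (h0 : z 0 ≤ c) (hc : 1 + b * c * Real.cos c = 0) :
    ∀ t ∈ Icc 0 T, z t ≤ c := by
  intro t ht
  by_contra! hlt
  have hsub : Icc 0 t ⊆ Icc 0 T := Icc_subset_Icc_right ht.2
  obtain ⟨t₁, ht₁, hzt₁⟩ : c ∈ z '' Icc 0 t :=
    intermediate_value_Icc ht.1 (hz.mono hsub) ⟨h0, hlt.le⟩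
  have hsub' : Icc t₁ t ⊆ Icc 0 T := fun s hs => ⟨ht₁.1.trans hs.1, hs.2.trans ht.2⟩
  obtain ⟨B, hB⟩ := isCompact_Icc.exists_bound_of_continuousOn (hz.mono hsub')
  have hB0 : ‖z t₁‖ ≤ B := hB t₁ ⟨le_rfl, ht₁.2⟩
  obtain ⟨K, hK⟩ := (show ContDiff ℝ 1 (fun y : ℝ => 1 + b * y * Real.cos y) by
    fun_prop).contDiffOn.exists_lipschitzOnWith one_ne_zero (convex_closedBall (0 : ℝ) B)
    (isCompact_closedBall 0 B)
  have hmem : ∀ s ∈ Ico t₁ t, z s ∈ Metric.closedBall (0 : ℝ) B := fun s hs => by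
    simpa using hB s ⟨hs.1, hs.2.le⟩
  have hcmem : c ∈ Metric.closedBall (0 : ℝ) B := by rw [← hzt₁]; simpa using hB0
  -- From the time `t₁` at which `z = c`, both `z` and the constant `c` solve the same equation, so
  -- `z t = c`, against `c < z t`.
  have key := ODE_solution_unique_of_mem_Icc_right
    (v := fun s y => g s * (1 + b * y * Real.cos y)) (s := fun _ => Metric.closedBall (0 : ℝ) B)
    (K := G.toNNReal * K) (f := z) (g := fun _ => c) (a := t₁) (b := t) ?_ (hz.mono hsub')
    (fun s hs => hz' s ⟨ht₁.1.trans hs.1, hs.2.trans_le ht.2⟩) hmem continuousOn_const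
    (fun s _ => by simpa [hc] using hasDerivWithinAt_const s (Ici s) c) (fun _ _ => hcmem) hzt₁
  · exact hlt.ne' (key ⟨ht₁.2, le_rfl⟩)
  · intro s hs
    have hgs := hg s ⟨ht₁.1.trans hs.1, hs.2.trans_le ht.2⟩
    refine LipschitzOnWith.of_dist_le_mul fun y hy y' hy' => ?_
    have h1 := hK.dist_le_mul y hy y' hy'
    rw [Real.dist_eq] at h1 ⊢
    rw [← mul_sub, abs_mul, NNReal.coe_mul]
    exact (mul_le_mul (hgs.trans (Real.le_coe_toNNReal G)) h1 (abs_nonneg _)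
      (by positivity)).trans_eq (mul_assoc _ _ _).symm

/-- The function `1 + b z cos z` has arbitrarily large zeros. -/
theorem exists_barrier {b : ℝ} (hb : b ≠ 0) (z₀ : ℝ) :
    ∃ c, z₀ ≤ c ∧ 1 + b * c * Real.cos c = 0 := by
  have hb' : 0 < |b| := abs_pos.2 hb
  obtain ⟨m, hm⟩ := exists_nat_ge (|z₀| + 1 / |b|)
  have h1 : 0 < 1 / |b| := by positivity
  have hπ := Real.pi_gt_three
  -- The cosine is `1` at `A` and `-1` at `A + π`. Once `|b| A ≥ 1`, the function has opposite weak
  -- signs at these two points.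
  set A : ℝ := m * (2 * Real.pi)
  have hA : |z₀| + 1 / |b| ≤ A := by
    have : (m : ℝ) * 1 ≤ m * (2 * Real.pi) := by gcongr; linarith
    simp only [A]; linarith
  have hA0 : 0 ≤ A := by positivity
  have hz₀ := le_abs_self z₀
  have hbA : 1 ≤ |b| * A := by
    have : |b| * (1 / |b|) ≤ |b| * A := by
      gcongr; linarith [abs_nonneg z₀]
    rwa [mul_one_div_cancel hb'.ne'] at this
  have hbπ : 1 ≤ |b| * (A + Real.pi) := hbA.trans (by gcongr; linarith)
  have hcos : Real.cos A = 1 := Real.cos_nat_mul_two_pi m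
  have hcos' : Real.cos (A + Real.pi) = -1 := by rw [Real.cos_add_pi, hcos]
  have hcont : ContinuousOn (fun z : ℝ => 1 + b * z * Real.cos z) (Icc A (A + Real.pi)) := by
    fun_prop
  have hle : A ≤ A + Real.pi := by linarith
  suffices h : (0 : ℝ) ∈ (fun z : ℝ => 1 + b * z * Real.cos z) '' Icc A (A + Real.pi) by
    obtain ⟨c, hc, hc0⟩ := h
    exact ⟨c, by linarith [hc.1], hc0⟩
  rcases lt_or_gt_of_ne hb with h | h
  · rw [abs_of_neg h] at hbA hbπ
    refine intermediate_value_Icc hle hcont ⟨?_, ?_⟩ <;> simp only [hcos, hcos'] <;> linarith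
  · rw [abs_of_pos h] at hbA hbπ
    refine intermediate_value_Icc' hle hcont ⟨?_, ?_⟩ <;> simp only [hcos, hcos'] <;> linarith

/-- A function with nonnegative right derivative is monotone. -/
theorem monotoneOn_of_deriv_right_nonneg {f P : ℝ → ℝ} {T : ℝ} (hP : ContinuousOn P (Icc 0 T))
    (hd : ∀ t ∈ Ico 0 T, HasDerivWithinAt P (f t) (Ici t) t) (hf : ∀ t ∈ Ico 0 T, 0 ≤ f t) :
    MonotoneOn P (Icc 0 T) := by
  intro s hs t ht hst
  have hsub : Icc s t ⊆ Icc 0 T := fun r hr => ⟨hs.1.trans hr.1, hr.2.trans ht.2⟩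
  exact image_le_of_deriv_right_le_deriv_boundary (f := fun _ => P s) (f' := fun _ => 0)
    continuousOn_const (fun x _ => hasDerivWithinAt_const x (Ici x) (P s)) le_rfl
    (hP.mono hsub) (fun r hr => hd r ⟨hs.1.trans hr.1, hr.2.trans_le ht.2⟩)
    (fun r hr => hf r ⟨hs.1.trans hr.1, hr.2.trans_le ht.2⟩) ⟨hst, le_rfl⟩

/-! ### Barbalat's lemma with switching -/

/-- **Barbalat's lemma** for functions that are Lipschitz between switching times. -/
theorem tendsto_zero_of_bounded_primitive {f P : ℝ → ℝ} {τ : ℕ → ℝ} {τmin L C : ℝ}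
    (hτmin : 0 < τmin) (hdwell : ∀ j, τmin < τ (j + 1) - τ j)
    (hcover : ∀ t, 0 ≤ t → ∃ j, t ∈ Ico (τ j) (τ (j + 1)))
    (hτ : ∀ j, 0 ≤ τ j)
    (hP : ContinuousOn P (Ici 0)) (hd : ∀ t, 0 ≤ t → HasDerivWithinAt P (f t) (Ici t) t)
    (hf : ∀ t, 0 ≤ t → 0 ≤ f t) (hC : ∀ t, 0 ≤ t → P t ≤ C)
    (hL : ∀ j, ∀ s ∈ Ico (τ j) (τ (j + 1)), ∀ t ∈ Ico (τ j) (τ (j + 1)),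
      |f s - f t| ≤ L * |s - t|) :
    Tendsto f atTop (𝓝 0) := by
  have hmono : ∀ s t, 0 ≤ s → s ≤ t → P s ≤ P t := fun s t hs hst =>
    monotoneOn_of_deriv_right_nonneg (T := t) (hP.mono Icc_subset_Ici_self)
      (fun r hr => hd r hr.1) (fun r hr => hf r hr.1) ⟨hs, hst⟩ ⟨hs.trans hst, le_rfl⟩ hst
  have hlim : Tendsto (fun t => P (max t 0)) atTop (𝓝 (⨆ t, P (max t 0))) := by
    refine tendsto_atTop_ciSup (fun s t hst => hmono _ _ (le_max_right _ _)
      (max_le_max_right 0 hst)) ⟨C, ?_⟩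
    rintro _ ⟨t, rfl⟩
    exact hC _ (le_max_right _ _)
  rw [Metric.tendsto_atTop]
  intro ε hε
  -- Half the dwell time ensures that `[t, t + δ]` or `[t - δ, t]` contains no switch in its
  -- interior; the second bound keeps `f ≥ ε / 2` there once `f t ≥ ε`. Then `P` grows by `ε / 2 *
  -- δ`, against convergence of `P`.
  set δ := min (τmin / 2) (ε / (2 * (|L| + 1))) with hδ
  have hδ0 : 0 < δ := by positivity
  have hδτ : δ ≤ τmin / 2 := min_le_left _ _
  have hδL : |L| * δ ≤ ε / 2 := by
    have h1 : δ * (2 * (|L| + 1)) ≤ ε := (le_div_iff₀ (by positivity)).1 (min_le_right _ _)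
    nlinarith
  have hcau : Tendsto (fun t => P (max (t + δ) 0) - P (max (t + -δ) 0)) atTop (𝓝 0) := by
    have := (hlim.comp (tendsto_atTop_add_const_right _ δ tendsto_id)).sub
      (hlim.comp (tendsto_atTop_add_const_right _ (-δ) tendsto_id))
    simpa using this
  obtain ⟨T, hT⟩ := Metric.tendsto_atTop.1 hcau (ε / 2 * δ) (by positivity)
  refine ⟨max T δ, fun t ht => ?_⟩
  have htT : T ≤ t := (le_max_left _ _).trans ht
  have htδ : δ ≤ t := (le_max_right _ _).trans ht
  have ht0 : 0 ≤ t := hδ0.le.trans htδ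
  rw [Real.dist_eq, sub_zero, abs_of_nonneg (hf t ht0)]
  by_contra! hge
  have hinc : P (t + δ) - P (t - δ) < ε / 2 * δ := by
    have := hT t htT
    rw [Real.dist_eq, sub_zero, max_eq_left (by linarith), max_eq_left (by linarith),
      ← sub_eq_add_neg] at this
    exact (le_abs_self _).trans_lt this
  obtain ⟨j, hj⟩ := hcover t ht0
  have hstep : ∀ s, τ j ≤ s → s + δ ≤ τ (j + 1) → t - δ ≤ s → s ≤ t →
      P s + ε / 2 * δ ≤ P (s + δ) := by
    intro s hs1 hs2 hs3 hs4
    have h0s : 0 ≤ s := (hτ j).trans hs1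
    have := image_le_of_deriv_right_le_deriv_boundary (f := fun r => P s + ε / 2 * (r - s))
      (f' := fun _ => ε / 2) (a := s) (b := s + δ) (B := P) (B' := f) (by fun_prop)
      (fun r _ => by
        simpa using (((hasDerivAt_id r).sub_const s).const_mul (ε / 2)).const_add (P s)
          |>.hasDerivWithinAt (s := Ici r))
      (by simp) (hP.mono fun r hr => h0s.trans hr.1) (fun r hr => hd r (h0s.trans hr.1))
      (fun r hr => ?_) (right_mem_Icc.2 (by linarith))
    · simpa using this
    · have h1 := hL j t hj r ⟨hs1.trans hr.1, hr.2.trans_le hs2⟩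
      have h2 : |t - r| ≤ δ := abs_le.2 ⟨by linarith [hr.2], by linarith [hr.1]⟩
      have h3 : L * |t - r| ≤ |L| * δ :=
        mul_le_mul (le_abs_self L) h2 (abs_nonneg _) (abs_nonneg _)
      have h4 := le_abs_self (f t - f r)
      linarith
  rcases le_or_gt (t + δ) (τ (j + 1)) with h | h
  · have h1 := hstep t hj.1 h (by linarith) le_rfl
    have h2 := hmono (t - δ) t (by linarith) (by linarith)
    linarith
  · have h1 := hstep (t - δ) (by linarith [hdwell j]) (by linarith [hj.2]) le_rfl (by linarith)
    have h2 := hmono t (t + δ) (by linarith) (by linarith)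
    rw [sub_add_cancel] at h1
    linarith

/-! ### Laplacians on basis bicomponents -/

theorem laplacian_mulVec {N : ℕ} (A : Matrix (Fin N) (Fin N) ℝ) (y : Fin N → ℝ) (i : Fin N) :
    (laplacian A).mulVec y i = ∑ k, A i k * (y i - y k) := by
  rw [laplacian, Matrix.sub_mulVec, Pi.sub_apply, Matrix.mulVec_diagonal, Finset.sum_mul]
  simp only [Matrix.mulVec, dotProduct, ← Finset.sum_sub_distrib, mul_sub]

/-- If `i` maximizes `y` over a set closed under taking in-neighbours
and `(L y)_i = 0`, then the in-neighbours of `i` have the same value as `i`. -/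
theorem eq_of_laplacian_eq_zero {N : ℕ} {A : Matrix (Fin N) (Fin N) ℝ} (hA : ∀ i k, 0 ≤ A i k)
    {S : Set (Fin N)} (hin : ∀ k i : Fin N, i ∈ S → (graphOf A).Adj k i → k ∈ S)
    {y : Fin N → ℝ} {i k : Fin N} (hi : i ∈ S) (hmax : ∀ j ∈ S, y j ≤ y i)
    (h0 : (laplacian A).mulVec y i = 0) (hk : (graphOf A).Adj k i) : y k = y i := by
  rw [laplacian_mulVec] at h0
  -- Only nodes with positive weight need to be compared with `i`, and those lie in `S`.
  have hnn : ∀ j ∈ Finset.univ, 0 ≤ A i j * (y i - y j) := by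
    intro j _
    rcases (hA i j).eq_or_lt with h | h
    · simp [← h]
    · exact mul_nonneg h.le (sub_nonneg.2 (hmax j (hin j i hi h)))
  have := (Finset.sum_eq_zero_iff_of_nonneg hnn).1 h0 k (Finset.mem_univ k)
  rcases mul_eq_zero.1 this with h | h
  · exact absurd h (ne_of_gt hk)
  · linarith

/-- A nonzero maximum over a basis bicomponent is attained everywhere. -/
theorem eq_of_isMax_of_isBasisBicomponent {N : ℕ} {A : Matrix (Fin N) (Fin N) ℝ}
    (hA : ∀ i k, 0 ≤ A i k) {S : Set (Fin N)} (hS : IsBasisBicomponent (graphOf A) S)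
    {y : Fin N → ℝ} (h0 : ∀ i ∈ S, y i * (laplacian A).mulVec y i = 0)
    {m : Fin N} (hm : m ∈ S) (hmax : ∀ j ∈ S, y j ≤ y m) (hne : y m ≠ 0) :
    ∀ i ∈ S, y i = y m := by
  intro i hi
  rcases eq_or_ne i m with rfl | him
  · rfl
  have hpath := hS.2.1 (⟨i, hi⟩ : S) ⟨m, hm⟩ (by simpa [Subtype.ext_iff] using him)
  have main : ∀ p : S, Relation.TransGen
      (⟨fun k i => (graphOf A).Adj k i⟩ : Digraph S).Adj p ⟨m, hm⟩ → y p = y m := by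
    intro p hp
    -- The maximum travels backwards along the path; being nonzero, it can be cancelled from `y d *
    -- (L y) d = 0`.
    have step : ∀ c d : S, (graphOf A).Adj c d → y d = y m → y c = y m := by
      intro c d hcd hd
      have := eq_of_laplacian_eq_zero hA hS.2.2 d.2 (fun j hj => by rw [hd]; exact hmax j hj)
        ((mul_eq_zero.1 (h0 d d.2)).resolve_left (by rw [hd]; exact hne)) hcd
      rw [this, hd]
    induction hp using Relation.TransGen.head_induction_on with
    | single h => exact step _ _ h rfl
    | head h _ ih => exact step _ _ h ih
  exact main _ hpath

/-- A nonzero maximum is handled directly and a nonzero minimum by passing to `-y`; if both are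
zero, `y` vanishes on `S`. -/
theorem eq_on_isBasisBicomponent {N : ℕ} {A : Matrix (Fin N) (Fin N) ℝ}
    (hA : ∀ i k, 0 ≤ A i k) {S : Set (Fin N)} (hS : IsBasisBicomponent (graphOf A) S)
    {y : Fin N → ℝ} (h0 : ∀ i ∈ S, y i * (laplacian A).mulVec y i = 0)
    {i k : Fin N} (hi : i ∈ S) (hk : k ∈ S) : y i = y k := by
  have hfin : S.Finite := S.toFinite
  obtain ⟨m, hm, hmax⟩ := Set.exists_max_image S y hfin hS.1
  obtain ⟨p, hp, hmin⟩ := Set.exists_min_image S y hfin hS.1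
  by_cases h1 : y m = 0
  · by_cases h2 : y p = 0
    · have : ∀ j ∈ S, y j = 0 := fun j hj =>
        le_antisymm ((hmax j hj).trans_eq h1) (h2.symm.trans_le (hmin j hj))
      rw [this i hi, this k hk]
    · have h0' : ∀ i ∈ S, (-y) i * (laplacian A).mulVec (-y) i = 0 := fun i hi => by
        rw [Matrix.mulVec_neg]; simpa using h0 i hi
      have := eq_of_isMax_of_isBasisBicomponent hA hS h0' hp
        (fun j hj => by simpa using hmin j hj) (by simpa using h2)
      have hi' := this i hi
      have hk' := this k hk
      simp only [Pi.neg_apply, neg_inj] at hi' hk'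
      rw [hi', hk']
  · have := eq_of_isMax_of_isBasisBicomponent hA hS h0 hm hmax h1
    rw [this i hi, this k hk]

/-- If the products `y_i (L y)_i` are small on a basis bicomponent, then `y` is nearly constant
there. -/
theorem exists_pos_forall_abs_sub_lt {N : ℕ} {A : Matrix (Fin N) (Fin N) ℝ}
    (hA : ∀ i k, 0 ≤ A i k) {S : Set (Fin N)} (hS : IsBasisBicomponent (graphOf A) S)
    {i k : Fin N} (hi : i ∈ S) (hk : k ∈ S) (C : ℝ) {ε : ℝ} (hε : 0 < ε) :
    ∃ δ > 0, ∀ y : Fin N → ℝ, ‖y‖ ≤ C → (∀ j, |y j * (laplacian A).mulVec y j| ≤ δ) →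
      |y i - y k| < ε := by
  by_contra! hcon
  set K : Set (Fin N → ℝ) := Metric.closedBall 0 C ∩ {y | ε ≤ |y i - y k|}
  have hK : IsCompact K := (isCompact_closedBall 0 C).inter_right
    (isClosed_le continuous_const (by fun_prop))
  set f : (Fin N → ℝ) → ℝ := fun y => ‖fun j => y j * (laplacian A).mulVec y j‖
  have hf : Continuous f := by
    refine Continuous.norm (continuous_pi fun j => ?_)
    simp only [laplacian_mulVec]
    fun_prop
  -- The value `1` only shows that `K` is nonempty. Half the minimum of `f` over `K` is the
  -- tolerance that leads to the contradiction.
  obtain ⟨y₀, h1, -, h2⟩ := hcon 1 one_pos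
  obtain ⟨y₁, hy₁, hmin⟩ := hK.exists_isMinOn ⟨y₀, by simpa using h1, h2⟩ hf.continuousOn
  have hpos : 0 < f y₁ := by
    refine (norm_nonneg _).lt_of_ne fun h => ?_
    have hz := norm_eq_zero.1 h.symm
    have := eq_on_isBasisBicomponent hA hS (y := y₁) (fun j _ => congrFun hz j) hi hk
    have h3 : ε ≤ |y₁ i - y₁ k| := hy₁.2
    rw [this, sub_self, abs_zero] at h3
    exact absurd h3 (not_le.2 hε)
  obtain ⟨y₂, h1, h2, h3⟩ := hcon (f y₁ / 2) (half_pos hpos)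
  have h4 : f y₁ ≤ f y₂ := hmin (⟨by simpa using h1, h3⟩ : y₂ ∈ K)
  have h5 : f y₂ ≤ f y₁ / 2 := (pi_norm_le_iff_of_nonneg (half_pos hpos).le).2 h2
  linarith

/-! ### Switching times and activation of topologies -/

namespace SwitchingTopology

variable {N M : ℕ} {A : Fin M → Matrix (Fin N) (Fin N) ℝ} {τ : ℕ → ℝ} {n : ℕ → Fin M}
  {a : ℝ → Matrix (Fin N) (Fin N) ℝ}

theorem strictMono (h : SwitchingTopology A τ n a) : StrictMono τ := by
  obtain ⟨τmin, h0, h1⟩ := h.dwell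
  exact strictMono_nat_of_lt_succ fun j => by linarith [h1 j]

theorem nonneg (h : SwitchingTopology A τ n a) (j : ℕ) : 0 ≤ τ j := by
  rw [← h.start]; exact h.strictMono.monotone (Nat.zero_le j)

/-- The dwell time makes the switching times grow at least linearly, so they do not accumulate. -/
theorem exists_mem_Ico (h : SwitchingTopology A τ n a) {t : ℝ} (ht : 0 ≤ t) :
    ∃ j, t ∈ Ico (τ j) (τ (j + 1)) := by
  obtain ⟨τmin, h0, h1⟩ := h.dwell
  have hlin : ∀ j : ℕ, j * τmin ≤ τ j := by
    intro j
    induction j with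
    | zero => simp [h.start]
    | succ j ih => push_cast; linarith [h1 j]
  have hex : ∃ j, t < τ (j + 1) := by
    obtain ⟨j, hj⟩ := exists_nat_gt (t / τmin)
    refine ⟨j, ?_⟩
    have := (div_lt_iff₀ h0).1 hj
    linarith [hlin j, h1 j]
  classical
  refine ⟨Nat.find hex, ?_, Nat.find_spec hex⟩
  rcases hj : Nat.find hex with _ | j
  · rwa [h.start]
  · exact not_lt.1 (Nat.find_min hex (by omega))

theorem exists_eq (h : SwitchingTopology A τ n a) {t : ℝ} (ht : 0 ≤ t) : ∃ l, a t = A l :=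
  let ⟨j, hj⟩ := h.exists_mem_Ico ht
  ⟨n j, h.active j t hj⟩

/-- The topology does not change immediately after a given time. -/
theorem eventually_eq_right (h : SwitchingTopology A τ n a) {t : ℝ} (ht : 0 ≤ t) :
    ∀ᶠ s in 𝓝[≥] t, a s = a t := by
  obtain ⟨j, hj⟩ := h.exists_mem_Ico ht
  filter_upwards [Ico_mem_nhdsGE hj.2] with s hs
  rw [h.active j t hj, h.active j s ⟨hj.1.trans hs.1, hs.2⟩]

theorem mem_Ioo_of_notMem_range {j : ℕ} {t : ℝ} (hj : t ∈ Ico (τ j) (τ (j + 1)))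
    (ht : t ∉ range τ) : t ∈ Ioo (τ j) (τ (j + 1)) :=
  ⟨lt_of_le_of_ne hj.1 fun h' => ht ⟨j, h'⟩, hj.2⟩

/-- The topology is locally constant in time away from the switching times. -/
theorem eventually_eq (h : SwitchingTopology A τ n a) {t : ℝ} (ht : 0 ≤ t) (hτ : t ∉ range τ) :
    ∀ᶠ s in 𝓝 t, a s = a t := by
  obtain ⟨j, hj⟩ := h.exists_mem_Ico ht
  have hj' := mem_Ioo_of_notMem_range hj hτ
  filter_upwards [Ioo_mem_nhds hj'.1 hj'.2] with s hs
  rw [h.active j t hj, h.active j s ⟨hs.1.le, hs.2⟩]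

theorem eventually_right_notMem_range (h : SwitchingTopology A τ n a) {t : ℝ} (ht : 0 ≤ t) :
    ∀ᶠ s in 𝓝[>] t, s ∉ range τ := by
  obtain ⟨j, hj⟩ := h.exists_mem_Ico ht
  filter_upwards [Ioo_mem_nhdsGT hj.2] with s hs
  rintro ⟨m, rfl⟩
  have h1 := h.strictMono.lt_iff_lt.1 (hj.1.trans_lt hs.1)
  have h2 := h.strictMono.lt_iff_lt.1 hs.2
  omega

/-- Every topology is active within bounded time after any given (large) time. -/
theorem exists_active (h : SwitchingTopology A τ n a) (l : Fin M) :
    ∃ T D : ℝ, 0 ≤ T ∧ 0 < D ∧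
      ∀ t, T ≤ t → ∃ s, t ≤ s ∧ s ≤ t + D ∧ laplacian (a s) = laplacian (A l) := by
  obtain ⟨Ta, Td, τmax, h0, hr, hlt, hact, hgap⟩ := h.reactivation l
  obtain ⟨τmin, h2, h1⟩ := h.dwell
  -- Both ends are switching times, so an active interval contains a full dwell interval; hence the
  -- activation times tend to infinity.
  have hlen : ∀ ν, τmin ≤ Td ν - Ta ν := by
    intro ν
    obtain ⟨⟨i, hi⟩, ⟨j, hj⟩⟩ := hr ν
    have h3 := (hlt ν).1
    rw [← hi, ← hj] at h3 ⊢
    have h4 : i + 1 ≤ j := h.strictMono.lt_iff_lt.1 h3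
    linarith [h.strictMono.monotone h4, h1 i]
  have hlin : ∀ ν : ℕ, Ta 0 + ν * τmin ≤ Ta ν := by
    intro ν
    induction ν with
    | zero => simp
    | succ ν ih => push_cast; linarith [hlen ν, (hlt ν).2]
  have hTa : 0 ≤ Ta 0 := by
    obtain ⟨i, hi⟩ := (hr 0).1
    rw [← hi]; exact h.nonneg i
  refine ⟨Ta 0, τmax, hTa, h0, fun t ht => ?_⟩
  have hex : ∃ ν, t < Ta (ν + 1) := by
    obtain ⟨ν, hν⟩ := exists_nat_gt (t / τmin)
    refine ⟨ν, ?_⟩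
    have := (div_lt_iff₀ h2).1 hν
    have := hlin (ν + 1)
    push_cast at this
    linarith
  classical
  obtain ⟨ν, hν, hνt⟩ : ∃ ν, Ta ν ≤ t ∧ t < Ta (ν + 1) := by
    refine ⟨Nat.find hex, ?_, Nat.find_spec hex⟩
    rcases hj : Nat.find hex with _ | j
    · exact ht
    · exact not_lt.1 (Nat.find_min hex (by omega))
  rcases lt_or_ge t (Td ν) with h3 | h3
  · exact ⟨t, le_rfl, by linarith, hact ν t ⟨hν, h3⟩⟩
  · exact ⟨Ta (ν + 1), hνt.le, by linarith [hgap ν], hact (ν + 1) _ ⟨le_rfl, (hlt (ν + 1)).1⟩⟩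

end SwitchingTopology

/-- If each topology has vanishing differences on its basis bicomponents, then all differences
vanish. -/
theorem JointlyStronglyConnectedBasis.tendsto_sub {V ι : Type*} {G : ι → Digraph V}
    (h : JointlyStronglyConnectedBasis G) {x : V → ℝ → ℝ}
    (hx : ∀ l S, IsBasisBicomponent (G l) S → ∀ i ∈ S, ∀ k ∈ S,
      Tendsto (fun t => x i t - x k t) atTop (𝓝 0)) (i k : V) :
    Tendsto (fun t => x i t - x k t) atTop (𝓝 0) := by
  rcases eq_or_ne i k with rfl | hik
  · simp
  have hp := h.2 i k hik
  induction hp with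
  | single hs =>
    obtain ⟨l, S, hS, hi, hk, -⟩ := hs
    exact hx l S hS _ hi _ hk
  | @tail c d hs1 hs ih =>
    obtain ⟨l, S, hS, hi, hk, -⟩ := hs
    have h1 : Tendsto (fun t => x i t - x c t) atTop (𝓝 0) := by
      rcases eq_or_ne i c with rfl | hic
      · simp
      · exact ih hic
    simpa using h1.add (hx l S hS _ hi _ hk)

/-! ### Concatenation of integral curves -/

/-- Integral curves on consecutive intervals are concatenated to a curve on `[0, ∞)`. -/
theorem exists_concatenation {E : Type*} [NormedAddCommGroup E] [NormedSpace ℝ E] {τ : ℕ → ℝ}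
    (hτ : StrictMono τ) (h0 : τ 0 = 0) (hcover : ∀ t, 0 ≤ t → ∃ j, t ∈ Ico (τ j) (τ (j + 1)))
    {f : ℕ → E → E}
    (hf : ∀ j y, ∃ α : ℝ → E, α (τ j) = y ∧
      ∀ t ∈ Icc (τ j) (τ (j + 1)), HasDerivAt α (f j (α t)) t) (y₀ : E) :
    ∃ y : ℝ → E, y 0 = y₀ ∧ ContinuousOn y (Ici 0) ∧
      (∀ j, ∀ t ∈ Ico (τ j) (τ (j + 1)), HasDerivWithinAt y (f j (y t)) (Ici t) t) ∧
      ∀ j, ∀ t ∈ Ioo (τ j) (τ (j + 1)), HasDerivAt y (f j (y t)) t := by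
  choose α hα0 hα using hf
  choose! J hJ using hcover
  have huniq : ∀ j t, t ∈ Ico (τ j) (τ (j + 1)) → J t = j := by
    intro j t ht
    have h1 := hJ t (by rw [← h0]; exact (hτ.monotone (Nat.zero_le j)).trans ht.1)
    have h2 := hτ.lt_iff_lt.1 (h1.1.trans_lt ht.2)
    have h3 := hτ.lt_iff_lt.1 (ht.1.trans_lt h1.2)
    omega
  set c : ℕ → E := fun j => Nat.rec y₀ (fun j y => α j y (τ (j + 1))) j
  set y : ℝ → E := fun t => α (J t) (c (J t)) t
  have hy : ∀ j, ∀ t ∈ Ico (τ j) (τ (j + 1)), y t = α j (c j) t := by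
    intro j t ht
    simp only [y, huniq j t ht]
  have hyc : ∀ j, y (τ j) = c j := by
    intro j
    rw [hy j (τ j) ⟨le_rfl, hτ (Nat.lt_succ_self j)⟩, hα0]
  have hright : ∀ j, ∀ t ∈ Ico (τ j) (τ (j + 1)), HasDerivWithinAt y (f j (y t)) (Ici t) t := by
    intro j t ht
    have h1 := (hα j (c j) t (Ico_subset_Icc_self ht)).hasDerivWithinAt (s := Ici t)
    rw [← hy j t ht] at h1
    refine h1.congr_of_eventuallyEq ?_ (hy j t ht)
    filter_upwards [Ico_mem_nhdsGE ht.2] with s hs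
    exact hy j s ⟨ht.1.trans hs.1, hs.2⟩
  have hmid : ∀ j, ∀ t ∈ Ioo (τ j) (τ (j + 1)), HasDerivAt y (f j (y t)) t := by
    intro j t ht
    have h1 := hα j (c j) t (Ioo_subset_Icc_self ht)
    rw [← hy j t (Ioo_subset_Ico_self ht)] at h1
    refine h1.congr_of_eventuallyEq ?_
    filter_upwards [Ioo_mem_nhds ht.1 ht.2] with s hs
    exact hy j s (Ioo_subset_Ico_self hs)
  refine ⟨y, (congrArg y h0).symm.trans (hyc 0), fun t ht => ?_, hright, hmid⟩
  have hjt := hJ t ht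
  -- At a positive switching time, continuity from the left comes from the preceding piece, whose
  -- end value is the start value `c (j + 1)` of the next. At time `0` only the right side matters.
  rcases hjt.1.eq_or_lt with heq | hlt
  · rcases hj : J t with _ | j
    · have h2 := (hright _ t hjt).continuousWithinAt
      refine h2.mono ?_
      rw [hj, h0] at heq
      rw [heq]
    · rw [hj] at heq
      have h3 : ContinuousWithinAt y (Iic t) t := by
        have h4 := (hα j (c j) t ⟨by rw [← heq]; exact hτ.monotone j.le_succ, heq.ge⟩)
          |>.continuousAt.continuousWithinAt (s := Iic t)
        have hyt : y t = α j (c j) t := by rw [← heq, hyc]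
        refine h4.congr_of_eventuallyEq ?_ hyt
        have hjlt : τ j < t := heq ▸ hτ j.lt_succ_self
        filter_upwards [Ioc_mem_nhdsLE hjlt] with s hs
        rcases hs.2.eq_or_lt with rfl | hst
        · exact hyt
        · exact hy j s ⟨hs.1.le, heq ▸ hst⟩
      exact (continuousAt_iff_continuous_left_right.2
        ⟨h3, (hright _ t hjt).continuousWithinAt⟩).continuousWithinAt
  · exact (hmid _ t ⟨hlt, hjt.2⟩).continuousAt.continuousWithinAt

/-! ### The closed loop as an ODE for the augmented state -/

/-- States of the closed loop: positions, velocities, the integrals `∫ qᵢ rᵢ`, and the integrals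
`λ₁ ∫ qᵢ² rᵢ² + ∫ vᵢ²`. -/
abbrev State (N : ℕ) := Fin 4 → Fin N → ℝ

namespace State

noncomputable section

variable {N : ℕ}

def q (ρ : ℝ) (y : State N) (i : Fin N) : ℝ := y 1 i + ρ * y 0 i

def r (ρ : ℝ) (A : Matrix (Fin N) (Fin N) ℝ) (y : State N) (i : Fin N) : ℝ :=
  ∑ k, A i k * (y 1 i - y 1 k) + ρ * ∑ k, A i k * (y 0 i - y 0 k)

def R (ρ l₂ : ℝ) (y : State N) (i : Fin N) : ℝ :=
  1 / 2 * q ρ y i ^ 2 + ρ / 2 * y 0 i ^ 2 + y 3 i + l₂ / 2 * y 2 i ^ 2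

/-- The control input divided by `R cos R`. -/
def gain (ρ l₁ l₂ : ℝ) (A : Matrix (Fin N) (Fin N) ℝ) (y : State N) (i : Fin N) : ℝ :=
  (ρ + 1) * y 1 i + r ρ A y i * (l₁ * (q ρ y i * r ρ A y i) + l₂ * y 2 i)

def u (ρ l₁ l₂ : ℝ) (A : Matrix (Fin N) (Fin N) ℝ) (y : State N) (i : Fin N) : ℝ :=
  R ρ l₂ y i * Real.cos (R ρ l₂ y i) * gain ρ l₁ l₂ A y i

/-- The vector field of the closed loop with a fixed topology. -/
def field (b : Fin N → ℝ) (ρ l₁ l₂ : ℝ) (A : Matrix (Fin N) (Fin N) ℝ) (y : State N) : State N :=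
  ![y 1, fun i => b i * u ρ l₁ l₂ A y i, fun i => q ρ y i * r ρ A y i,
    fun i => l₁ * (q ρ y i ^ 2 * r ρ A y i ^ 2) + y 1 i ^ 2]

theorem contDiff_coord (m : Fin 4) (i : Fin N) : ContDiff ℝ 1 fun y : State N => y m i :=
  contDiff_pi.1 (contDiff_pi.1 contDiff_id m) i

@[fun_prop]
theorem contDiff_q (ρ : ℝ) (i : Fin N) : ContDiff ℝ 1 fun y : State N => q ρ y i := by
  unfold q; fun_prop

@[fun_prop]
theorem contDiff_r (ρ : ℝ) (A : Matrix (Fin N) (Fin N) ℝ) (i : Fin N) :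
    ContDiff ℝ 1 fun y : State N => r ρ A y i := by
  unfold r; fun_prop

@[fun_prop]
theorem contDiff_R (ρ l₂ : ℝ) (i : Fin N) : ContDiff ℝ 1 fun y : State N => R ρ l₂ y i := by
  unfold R; fun_prop

@[fun_prop]
theorem contDiff_gain (ρ l₁ l₂ : ℝ) (A : Matrix (Fin N) (Fin N) ℝ) (i : Fin N) :
    ContDiff ℝ 1 fun y : State N => gain ρ l₁ l₂ A y i := by
  unfold gain; fun_prop

@[fun_prop]
theorem contDiff_u (ρ l₁ l₂ : ℝ) (A : Matrix (Fin N) (Fin N) ℝ) (i : Fin N) :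
    ContDiff ℝ 1 fun y : State N => u ρ l₁ l₂ A y i := by
  unfold u; fun_prop

theorem contDiff_field (b : Fin N → ℝ) (ρ l₁ l₂ : ℝ) (A : Matrix (Fin N) (Fin N) ℝ) :
    ContDiff ℝ 1 (field b ρ l₁ l₂ A) := by
  refine contDiff_pi.2 fun m => contDiff_pi.2 fun i => ?_
  fin_cases m
  · exact contDiff_coord 1 i
  · exact (contDiff_u ρ l₁ l₂ A i).const_smul (b i)
  · exact (contDiff_q ρ i).mul (contDiff_r ρ A i)
  · change ContDiff ℝ 1 fun y : State N => l₁ * (q ρ y i ^ 2 * r ρ A y i ^ 2) + y 1 i ^ 2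
    fun_prop

/-- Turns smallness of `q_i r_i` into the hypothesis of the maximum principle for `y = q`. -/
theorem r_eq_laplacian (ρ : ℝ) (A : Matrix (Fin N) (Fin N) ℝ) (y : State N) (i : Fin N) :
    r ρ A y i = (laplacian A).mulVec (q ρ y) i := by
  rw [laplacian_mulVec, r, Finset.mul_sum, ← Finset.sum_add_distrib]
  exact Finset.sum_congr rfl fun k _ => by simp only [q]; ring

/-- A curve in the state space that follows the closed-loop vector field for the topology `a t`,
at a variable speed `χ t`. -/
structure IsTrajectory (b : Fin N → ℝ) (ρ l₁ l₂ : ℝ) (a : ℝ → Matrix (Fin N) (Fin N) ℝ)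
    (χ : ℝ → ℝ) (T : ℝ) (y : ℝ → State N) : Prop where
  continuousOn : ContinuousOn y (Icc 0 T)
  deriv : ∀ t ∈ Ico 0 T, HasDerivWithinAt y (χ t • field b ρ l₁ l₂ (a t) (y t)) (Ici t) t

variable {b : Fin N → ℝ} {ρ l₁ l₂ : ℝ} {a : ℝ → Matrix (Fin N) (Fin N) ℝ} {χ : ℝ → ℝ} {T : ℝ}
  {y : ℝ → State N}

namespace IsTrajectory

theorem deriv_coord (h : IsTrajectory b ρ l₁ l₂ a χ T y) {t : ℝ} (ht : t ∈ Ico 0 T) (m : Fin 4)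
    (i : Fin N) :
    HasDerivWithinAt (fun t => y t m i) (χ t * field b ρ l₁ l₂ (a t) (y t) m i) (Ici t) t :=
  hasDerivWithinAt_pi.1 (hasDerivWithinAt_pi.1 (h.deriv t ht) m) i

theorem continuousOn_comp (h : IsTrajectory b ρ l₁ l₂ a χ T y) {F : State N → ℝ}
    (hF : ContDiff ℝ 1 F) : ContinuousOn (fun t => F (y t)) (Icc 0 T) :=
  hF.continuous.comp_continuousOn h.continuousOn

/-- The gain is designed for this factorization: `ρ q v + ρ x v + v² = (ρ + 1) q v`, so the terms
without `b` add up to `q * gain`, while `b q u` contributes the same product times `b R cos R`. -/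
theorem deriv_R (h : IsTrajectory b ρ l₁ l₂ a χ T y) {t : ℝ} (ht : t ∈ Ico 0 T) (i : Fin N) :
    HasDerivWithinAt (fun t => R ρ l₂ (y t) i)
      ((χ t * (q ρ (y t) i * gain ρ l₁ l₂ (a t) (y t) i)) *
        (1 + b i * R ρ l₂ (y t) i * Real.cos (R ρ l₂ (y t) i))) (Ici t) t := by
  have h0 := h.deriv_coord ht 0 i
  have h1 := h.deriv_coord ht 1 i
  have h2 := h.deriv_coord ht 2 i
  have h3 := h.deriv_coord ht 3 i
  have hq := h1.add (h0.const_mul ρ)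
  have := ((((hq.pow 2).const_mul (1 / 2)).add ((h0.pow 2).const_mul (ρ / 2))).add h3).add
    ((h2.pow 2).const_mul (l₂ / 2))
  refine this.congr_deriv ?_
  simp [field, gain, u, q]
  ring

variable {M : ℕ} {A : Fin M → Matrix (Fin N) (Fin N) ℝ}

theorem integral_nonneg (h : IsTrajectory b ρ l₁ l₂ a χ T y) (hl₁ : 0 < l₁)
    (hχ : ∀ t, 0 ≤ χ t) {i : Fin N} (h0 : y 0 3 i = 0) {t : ℝ} (ht : t ∈ Icc 0 T) :
    0 ≤ y t 3 i := by
  rw [← h0]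
  refine monotoneOn_of_deriv_right_nonneg (h.continuousOn_comp (contDiff_coord 3 i))
    (fun s hs => h.deriv_coord hs 3 i) (fun s _ => mul_nonneg (hχ s) ?_)
    ⟨le_rfl, ht.1.trans ht.2⟩ ht ht.1
  change 0 ≤ l₁ * (q ρ (y s) i ^ 2 * r ρ (a s) (y s) i ^ 2) + y s 1 i ^ 2
  positivity

/-- The factor `χ * q * gain` is bounded on `[0, T]` by compactness and finiteness of the set of
topologies. That bound may depend on `T`, but the barrier `c` does not. -/
theorem R_le (h : IsTrajectory b ρ l₁ l₂ a χ T y) (ha : ∀ t, 0 ≤ t → ∃ l, a t = A l)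
    (hχ : ∀ t, 0 ≤ χ t) (hχ' : ∀ t, χ t ≤ 1) {i : Fin N} {c : ℝ} (h0 : R ρ l₂ (y 0) i ≤ c)
    (hc : 1 + b i * c * Real.cos c = 0) {t : ℝ} (ht : t ∈ Icc 0 T) : R ρ l₂ (y t) i ≤ c := by
  have hbd : ∀ l, ∃ G, ∀ s ∈ Icc 0 T, ‖q ρ (y s) i * gain ρ l₁ l₂ (A l) (y s) i‖ ≤ G := fun l =>
    isCompact_Icc.exists_bound_of_continuousOn
      (h.continuousOn_comp ((contDiff_q ρ i).mul (contDiff_gain ρ l₁ l₂ (A l) i)))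
  choose G hG using hbd
  obtain ⟨G', hG'⟩ := (Set.finite_range G).bddAbove
  refine le_of_barrier (G := G') (h.continuousOn_comp (contDiff_R ρ l₂ i))
    (fun s hs => h.deriv_R hs i) (fun s hs => ?_) h0 hc t ht
  obtain ⟨l, hl⟩ := ha s hs.1
  rw [abs_mul, abs_of_nonneg (hχ s), hl]
  exact (mul_le_of_le_one_left (abs_nonneg _) (hχ' s)).trans
    ((hG l s (Ico_subset_Icc_self hs)).trans (hG' ⟨l, rfl⟩))

end IsTrajectory

/-- A bound on the PI function bounds the state. -/
theorem abs_coord_le {c : ℝ} (hρ : 0 < ρ) (hl₂ : 0 < l₂) {y : State N} {i : Fin N}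
    (h3 : 0 ≤ y 3 i) (hR : R ρ l₂ y i ≤ c) (m : Fin 4) :
    -- A common bound for all four coordinates: the three groups bound `x`, `v = q - ρ x` and `∫ q
    -- r`, using `|z| ≤ z² + 1`; the last coordinate is at most `c`.
    |y m i| ≤ 2 * c / ρ + 1 + (4 * c + 1 + ρ) + (2 * c / l₂ + 1) := by
  have habs : ∀ z : ℝ, |z| ≤ z ^ 2 + 1 := fun z => by
    nlinarith [sq_abs z, sq_nonneg (|z| - 1), abs_nonneg z]
  unfold R at hR
  have hq := sq_nonneg (q ρ y i)
  have hx : 0 ≤ ρ / 2 * y 0 i ^ 2 := by positivity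
  have hw : 0 ≤ l₂ / 2 * y 2 i ^ 2 := by positivity
  have hc : 0 ≤ c := by linarith
  have hcρ : 0 ≤ 2 * c / ρ := by positivity
  have hcl : 0 ≤ 2 * c / l₂ := by positivity
  have hx' : y 0 i ^ 2 ≤ 2 * c / ρ := by rw [le_div_iff₀ hρ]; linarith
  have hw' : y 2 i ^ 2 ≤ 2 * c / l₂ := by rw [le_div_iff₀ hl₂]; linarith
  fin_cases m
  · change |y 0 i| ≤ _
    linarith [habs (y 0 i)]
  · change |y 1 i| ≤ _
    have h1 : y 1 i = q ρ y i - ρ * y 0 i := by simp [q]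
    have h2 : |y 1 i| ≤ |q ρ y i| + ρ * |y 0 i| := by
      rw [h1]
      refine (abs_sub _ _).trans ?_
      rw [abs_mul, abs_of_pos hρ]
    have h4 : ρ * |y 0 i| ≤ ρ * (y 0 i ^ 2 + 1) := by gcongr; exact habs _
    linarith [habs (q ρ y i)]
  · change |y 2 i| ≤ _
    linarith [habs (y 2 i)]
  · change |y 3 i| ≤ _
    rw [abs_of_nonneg h3]
    linarith

/-- Trajectories are bounded uniformly in time, and in the speed with which they are traversed. -/
theorem exists_bound_trajectory {M : ℕ} {A : Fin M → Matrix (Fin N) (Fin N) ℝ}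
    (hb : ∀ i, b i ≠ 0) (hρ : 0 < ρ) (hl₁ : 0 < l₁) (hl₂ : 0 < l₂)
    (ha : ∀ t, 0 ≤ t → ∃ l, a t = A l) (y₀ : State N) (h3 : y₀ 3 = 0) :
    ∃ K : ℝ, 0 < K ∧ ∀ (χ : ℝ → ℝ) (T : ℝ) (y : ℝ → State N), (∀ t, 0 ≤ χ t) → (∀ t, χ t ≤ 1) →
      IsTrajectory b ρ l₁ l₂ a χ T y → y 0 = y₀ → ∀ t ∈ Icc 0 T, ‖y t‖ ≤ K := by
  choose c hc0 hc using fun i => exists_barrier (hb i) (R ρ l₂ y₀ i)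
  set B : Fin N → ℝ := fun i => 2 * c i / ρ + 1 + (4 * c i + 1 + ρ) + (2 * c i / l₂ + 1)
  obtain ⟨K, hK⟩ := (Set.finite_range B).bddAbove
  refine ⟨max K 1, by positivity, fun χ T y hχ hχ' hy h0 t ht => ?_⟩
  refine (pi_norm_le_iff_of_nonneg (by positivity)).2 fun m =>
    (pi_norm_le_iff_of_nonneg (by positivity)).2 fun i => ?_
  refine (abs_coord_le hρ hl₂ (hy.integral_nonneg hl₁ hχ (by rw [h0, h3]; rfl) ht)
    (hy.R_le ha hχ hχ' (by rw [h0]; exact hc0 i) (hc i) ht) m).trans ?_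
  exact (hK ⟨i, rfl⟩).trans (le_max_left _ _)

/-- A trajectory is determined by its initial value. -/
theorem IsTrajectory.eqOn {M : ℕ} {A : Fin M → Matrix (Fin N) (Fin N) ℝ}
    (ha : ∀ t, 0 ≤ t → ∃ l, a t = A l) {y' : ℝ → State N}
    (h : IsTrajectory b ρ l₁ l₂ a (fun _ => 1) T y)
    (h' : IsTrajectory b ρ l₁ l₂ a (fun _ => 1) T y') (h0 : y 0 = y' 0) :
    EqOn y y' (Icc 0 T) := by
  obtain ⟨B, hB⟩ := isCompact_Icc.exists_bound_of_continuousOn h.continuousOn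
  obtain ⟨B', hB'⟩ := isCompact_Icc.exists_bound_of_continuousOn h'.continuousOn
  have hlip := fun l => (contDiff_field b ρ l₁ l₂ (A l)).contDiffOn.exists_lipschitzOnWith
    one_ne_zero (convex_closedBall (0 : State N) (max B B')) (isCompact_closedBall _ _)
  choose K hK using hlip
  obtain ⟨K', hK'⟩ := (Set.finite_range K).bddAbove
  refine ODE_solution_unique_of_mem_Icc_right (v := fun t => field b ρ l₁ l₂ (a t))
    (s := fun _ => Metric.closedBall 0 (max B B')) (K := K') (fun t ht => ?_)
    h.continuousOn (fun t ht => by simpa using h.deriv t ht) (fun t ht => ?_)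
    h'.continuousOn (fun t ht => by simpa using h'.deriv t ht) (fun t ht => ?_) h0
  · obtain ⟨l, hl⟩ := ha t ht.1
    rw [hl]
    exact (hK l).weaken (hK' ⟨l, rfl⟩)
  · simpa using Or.inl (hB t (Ico_subset_Icc_self ht))
  · simpa using Or.inr (hB' t (Ico_subset_Icc_self ht))

end

end State

/-! ### Calculus with piecewise constant topology -/

namespace SwitchingTopology

open MeasureTheory

variable {N M : ℕ} {A : Fin M → Matrix (Fin N) (Fin N) ℝ} {τ : ℕ → ℝ} {n : ℕ → Fin M}
  {a : ℝ → Matrix (Fin N) (Fin N) ℝ}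

/-- The integrand is bounded, and continuous off the countable set of switching times. -/
theorem intervalIntegrable (h : SwitchingTopology A τ n a) {G : Matrix (Fin N) (Fin N) ℝ → ℝ → ℝ}
    {T : ℝ} (hT : 0 ≤ T) (hG : ∀ l, ContinuousOn (G (A l)) (Icc 0 T)) :
    IntervalIntegrable (fun s => G (a s) s) volume 0 T := by
  rw [intervalIntegrable_iff_integrableOn_Ioc_of_le hT]
  choose B hB using fun l => isCompact_Icc.exists_bound_of_continuousOn (hG l)
  obtain ⟨B', hB'⟩ := (Set.finite_range B).bddAbove
  refine IntegrableOn.of_bound (by simp) ?_ B' ?_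
  · have hae : (Ioc 0 T \ range τ : Set ℝ) =ᵐ[volume] Ioc 0 T :=
      sdiff_null_ae_eq_self ((countable_range τ).measure_zero volume)
    rw [← Measure.restrict_congr_set hae]
    refine ContinuousOn.aestronglyMeasurable (fun t ht => ?_)
      (measurableSet_Ioc.diff (countable_range τ).measurableSet)
    obtain ⟨l, hl⟩ := h.exists_eq ht.1.1.le
    have h1 := (hG l t (Ioc_subset_Icc_self ht.1)).mono
      (sdiff_subset.trans Ioc_subset_Icc_self : Ioc 0 T \ range τ ⊆ Icc 0 T)
    refine h1.congr_of_eventuallyEq ?_ (by rw [hl])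
    filter_upwards [mem_nhdsWithin_of_mem_nhds (h.eventually_eq ht.1.1.le ht.2)] with s hs
    rw [hs, hl]
  · refine (ae_restrict_iff' measurableSet_Ioc).2 (Eventually.of_forall fun t ht => ?_)
    obtain ⟨l, hl⟩ := h.exists_eq ht.1.le
    rw [hl]
    exact (hB l t (Ioc_subset_Icc_self ht)).trans (hB' ⟨l, rfl⟩)

theorem continuousWithinAt_Ici (h : SwitchingTopology A τ n a)
    {G : Matrix (Fin N) (Fin N) ℝ → ℝ → ℝ} {T : ℝ}
    (hG : ∀ l, ContinuousOn (G (A l)) (Ico 0 T)) {t : ℝ} (ht : t ∈ Ico 0 T) :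
    ContinuousWithinAt (fun s => G (a s) s) (Ici t) t := by
  obtain ⟨l, hl⟩ := h.exists_eq ht.1
  have h1 : ContinuousWithinAt (G (A l)) (Ici t) t := (hG l t ht).mono_of_mem_nhdsWithin
    (mem_of_superset (Ico_mem_nhdsGE ht.2) (Ico_subset_Ico_left ht.1))
  refine h1.congr_of_eventuallyEq ?_ (by rw [hl])
  filter_upwards [h.eventually_eq_right ht.1] with s hs
  rw [hs, hl]

theorem hasDerivWithinAt_integral (h : SwitchingTopology A τ n a)
    {G : Matrix (Fin N) (Fin N) ℝ → ℝ → ℝ} {T : ℝ}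
    (hG : ∀ l, ContinuousOn (G (A l)) (Ico 0 T)) {t : ℝ} (ht : t ∈ Ico 0 T) :
    HasDerivWithinAt (fun t => ∫ s in (0 : ℝ)..t, G (a s) s) (G (a t) t) (Ici t) t := by
  obtain ⟨T', hT'⟩ := exists_between ht.2
  have hint : ∀ r, 0 ≤ r → r < T → IntervalIntegrable (fun s => G (a s) s) volume 0 r :=
    fun r hr hrT => h.intervalIntegrable hr fun l =>
      (hG l).mono fun s hs => ⟨hs.1, hs.2.trans_lt hrT⟩
  refine intervalIntegral.integral_hasDerivWithinAt_right (t := Ioi t) (hint t ht.1 ht.2)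
    ⟨Ioc 0 T', ?_, ?_⟩ ((h.continuousWithinAt_Ici hG ht).mono Ioi_subset_Ici_self)
  · exact mem_of_superset (Ioc_mem_nhdsGT hT'.1) (Ioc_subset_Ioc_left ht.1)
  · have h0 := ht.1.trans hT'.1.le
    exact ((intervalIntegrable_iff_integrableOn_Ioc_of_le h0).1
      (hint T' h0 hT'.2)).aestronglyMeasurable

theorem continuousOn_integral (h : SwitchingTopology A τ n a)
    {G : Matrix (Fin N) (Fin N) ℝ → ℝ → ℝ} {T : ℝ}
    (hG : ∀ l, ContinuousOn (G (A l)) (Ico 0 T)) :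
    ContinuousOn (fun t => ∫ s in (0 : ℝ)..t, G (a s) s) (Ico 0 T) := by
  intro t ht
  obtain ⟨T', hT'⟩ := exists_between ht.2
  have h0 := ht.1.trans hT'.1.le
  have hint := h.intervalIntegrable (G := G) h0 fun l =>
      (hG l).mono fun s hs => ⟨hs.1, hs.2.trans_lt hT'.2⟩
  have h1 := intervalIntegral.continuousOn_primitive_interval' hint left_mem_uIcc
  rw [uIcc_of_le h0] at h1
  refine (h1 t ⟨ht.1, hT'.1.le⟩).mono_of_mem_nhdsWithin ?_
  rw [mem_nhdsWithin]
  exact ⟨Iio T', isOpen_Iio, hT'.1, fun s hs => ⟨hs.2.1, (show s < T' from hs.1).le⟩⟩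

/-- If a continuous function has a right-continuous derivative outside the switching times, then it
has this right derivative everywhere. -/
theorem hasDerivWithinAt_Ici (h : SwitchingTopology A τ n a) {x f : ℝ → ℝ} {T : ℝ}
    (hx : ContinuousOn x (Ico 0 T)) (hd : ∀ s ∈ Ico 0 T, s ∉ range τ → HasDerivAt x (f s) s)
    {t : ℝ} (ht : t ∈ Ico 0 T) (hf : ContinuousWithinAt f (Ici t) t) :
    HasDerivWithinAt x (f t) (Ici t) t := by
  obtain ⟨c, hc, hsub⟩ := (mem_nhdsGT_iff_exists_Ioo_subset).1
    (inter_mem (h.eventually_right_notMem_range ht.1) (Ioo_mem_nhdsGT ht.2))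
  have hd' : ∀ s ∈ Ioo t c, HasDerivAt x (f s) s := fun s hs =>
    hd s ⟨ht.1.trans hs.1.le, (hsub hs).2.2⟩ (hsub hs).1
  have hmem : Ioo t c ∈ 𝓝[>] t := Ioo_mem_nhdsGT hc
  refine hasDerivWithinAt_Ici_of_tendsto_deriv (s := Ioo t c)
    (fun s hs => (hd' s hs).differentiableAt.differentiableWithinAt)
    ((hx t ht).mono fun s hs => ⟨ht.1.trans hs.1.le, (hsub hs).2.2⟩) hmem ?_
  refine (hf.mono Ioi_subset_Ici_self).tendsto.congr' ?_
  filter_upwards [hmem] with s hs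
  exact (hd' s hs).deriv.symm

end SwitchingTopology

/-! ### From closed-loop solutions to trajectories; uniqueness -/

noncomputable section

variable {N M : ℕ} {A : Fin M → Matrix (Fin N) (Fin N) ℝ} {τ : ℕ → ℝ} {n : ℕ → Fin M}
  {a : ℝ → Matrix (Fin N) (Fin N) ℝ} {b : Fin N → ℝ} {ρ l₁ l₂ : ℝ} {x v : Fin N → ℝ → ℝ}

/-- The state of the closed loop along `(x, v)`. -/
def stateOf (ρ l₁ : ℝ) (a : ℝ → Matrix (Fin N) (Fin N) ℝ) (x v : Fin N → ℝ → ℝ) (t : ℝ) :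
    State N :=
  ![fun i => x i t, fun i => v i t, fun i => ∫ s in (0 : ℝ)..t, q ρ x v i s * r ρ a x v i s,
    fun i => l₁ * (∫ s in (0 : ℝ)..t, q ρ x v i s ^ 2 * r ρ a x v i s ^ 2)
      + ∫ s in (0 : ℝ)..t, v i s ^ 2]

theorem R_stateOf (i : Fin N) (t : ℝ) :
    State.R ρ l₂ (stateOf ρ l₁ a x v t) i = R ρ l₁ l₂ a x v i t := by
  simp only [State.R, State.q, stateOf, R, q, Matrix.cons_val]
  ring

theorem u_stateOf (i : Fin N) (t : ℝ) :
    State.u ρ l₁ l₂ (a t) (stateOf ρ l₁ a x v t) i = u ρ l₁ l₂ a x v i t := by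
  rw [State.u, R_stateOf]
  rfl

theorem IsClosedLoopSolution.mono {J J' : Set ℝ} (h : IsClosedLoopSolution b ρ l₁ l₂ τ a J x v)
    (hJ : J' ⊆ J) : IsClosedLoopSolution b ρ l₁ l₂ τ a J' x v :=
  ⟨fun i => (h.cont_x i).mono hJ, fun i => (h.cont_v i).mono hJ,
    fun i t ht => h.deriv_x i t (hJ ht), fun i t ht => h.deriv_v i t (hJ ht)⟩

theorem continuousOn_r {J : Set ℝ} (hx : ∀ i, ContinuousOn (x i) J) (hv : ∀ i, ContinuousOn (v i) J)
    (B : Matrix (Fin N) (Fin N) ℝ) (i : Fin N) :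
    ContinuousOn (r ρ (fun _ => B) x v i) J := by
  unfold r disagreement
  fun_prop

/-- The right-hand sides are right-continuous, so the equations hold for right derivatives even at
switching times. This lets the comparison and uniqueness arguments run across switches. -/
theorem IsClosedLoopSolution.isTrajectory (htop : SwitchingTopology A τ n a) {T T' : ℝ}
    (hT : T < T') (h : IsClosedLoopSolution b ρ l₁ l₂ τ a (Ico 0 T') x v) :
    State.IsTrajectory b ρ l₁ l₂ a (fun _ => 1) T (stateOf ρ l₁ a x v) := by
  have hx := h.cont_x
  have hv := h.cont_v
  have hq : ∀ i, ContinuousOn (q ρ x v i) (Ico 0 T') := fun i => by unfold q; fun_prop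
  have hr := fun (l : Fin M) i => continuousOn_r (ρ := ρ) hx hv (A l) i
  let G₁ i (B : Matrix (Fin N) (Fin N) ℝ) s := q ρ x v i s * r ρ (fun _ => B) x v i s
  let G₂ i (B : Matrix (Fin N) (Fin N) ℝ) s := q ρ x v i s ^ 2 * r ρ (fun _ => B) x v i s ^ 2
  let G₃ i (_ : Matrix (Fin N) (Fin N) ℝ) s := v i s ^ 2
  have hG₁ : ∀ i l, ContinuousOn (G₁ i (A l)) (Ico 0 T') := fun i l => (hq i).mul (hr l i)
  have hG₂ : ∀ i l, ContinuousOn (G₂ i (A l)) (Ico 0 T') := fun i l =>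
    ((hq i).pow 2).mul ((hr l i).pow 2)
  have hG₃ : ∀ i l, ContinuousOn (G₃ i (A l)) (Ico 0 T') := fun i l => (hv i).pow 2
  have hcont : ContinuousOn (stateOf ρ l₁ a x v) (Ico 0 T') := by
    refine continuousOn_pi.2 fun m => continuousOn_pi.2 fun i => ?_
    fin_cases m
    · exact hx i
    · exact hv i
    · exact htop.continuousOn_integral (hG₁ i)
    · exact ((htop.continuousOn_integral (hG₂ i)).const_smul l₁).add
        (htop.continuousOn_integral (hG₃ i))
  have hsub : Ico 0 T ⊆ Ico 0 T' := Ico_subset_Ico_right hT.le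
  refine ⟨hcont.mono fun s hs => ⟨hs.1, hs.2.trans_lt hT⟩, fun t ht => ?_⟩
  rw [one_smul]
  refine hasDerivWithinAt_pi.2 fun m => hasDerivWithinAt_pi.2 fun i => ?_
  have hu : ContinuousWithinAt (fun s => b i * u ρ l₁ l₂ a x v i s) (Ici t) t := by
    simp only [← u_stateOf]
    exact htop.continuousWithinAt_Ici (T := T')
      (G := fun B s => b i * State.u ρ l₁ l₂ B (stateOf ρ l₁ a x v s) i) (fun l =>
      (((State.contDiff_u ρ l₁ l₂ (A l) i).continuous.comp_continuousOn hcont).const_smul (b i)))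
      (hsub ht)
  have hv' : ContinuousWithinAt (v i) (Ici t) t :=
    htop.continuousWithinAt_Ici (G := fun _ => v i) (fun _ => hv i) (hsub ht)
  fin_cases m
  · exact htop.hasDerivWithinAt_Ici (hx i) (h.deriv_x i) (hsub ht) hv'
  · change HasDerivWithinAt (v i) (b i * State.u ρ l₁ l₂ (a t) (stateOf ρ l₁ a x v t) i) (Ici t) t
    rw [u_stateOf]
    exact htop.hasDerivWithinAt_Ici (hv i) (h.deriv_v i) (hsub ht) hu
  · exact htop.hasDerivWithinAt_integral (hG₁ i) (hsub ht)
  · exact ((htop.hasDerivWithinAt_integral (hG₂ i) (hsub ht)).const_mul l₁).add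
      (htop.hasDerivWithinAt_integral (hG₃ i) (hsub ht))

theorem stateOf_zero : stateOf ρ l₁ a x v 0 = ![fun i => x i 0, fun i => v i 0, 0, 0] := by
  funext m i
  fin_cases m <;> simp [stateOf]

/-- Uniqueness of closed-loop solutions. -/
theorem IsClosedLoopSolution.unique (htop : SwitchingTopology A τ n a) {T : ℝ}
    {x' v' : Fin N → ℝ → ℝ} (h : IsClosedLoopSolution b ρ l₁ l₂ τ a (Ico 0 T) x v)
    (h' : IsClosedLoopSolution b ρ l₁ l₂ τ a (Ico 0 T) x' v')
    (h0 : ∀ i, x i 0 = x' i 0 ∧ v i 0 = v' i 0) (i : Fin N) {t : ℝ} (ht : t ∈ Ico 0 T) :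
    x i t = x' i t ∧ v i t = v' i t := by
  have key := (h.isTrajectory htop ht.2).eqOn (fun s hs => htop.exists_eq hs)
    (h'.isTrajectory htop ht.2) (by
      rw [stateOf_zero, stateOf_zero]
      simp only [(h0 _).1, (h0 _).2]) ⟨ht.1, le_rfl⟩
  exact ⟨congrFun (congrFun key 0) i, congrFun (congrFun key 1) i⟩

end

/-! ### Existence -/

noncomputable section

variable {N M : ℕ} {A : Fin M → Matrix (Fin N) (Fin N) ℝ} {τ : ℕ → ℝ} {n : ℕ → Fin M}
  {a : ℝ → Matrix (Fin N) (Fin N) ℝ} {b : Fin N → ℝ} {ρ l₁ l₂ : ℝ} {x v : Fin N → ℝ → ℝ}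

/-- A curve that follows the closed-loop vector field is the state of a closed-loop solution. -/
theorem isClosedLoopSolution_of_field (htop : SwitchingTopology A τ n a) {y : ℝ → State N}
    (hcont : ContinuousOn y (Ici 0)) (h2 : y 0 2 = 0) (h3 : y 0 3 = 0)
    (hright : ∀ t, 0 ≤ t → HasDerivWithinAt y (State.field b ρ l₁ l₂ (a t) (y t)) (Ici t) t)
    (hd : ∀ t, 0 ≤ t → t ∉ range τ → HasDerivAt y (State.field b ρ l₁ l₂ (a t) (y t)) t) :
    IsClosedLoopSolution b ρ l₁ l₂ τ a (Ici 0) (fun i t => y t 0 i) (fun i t => y t 1 i) := by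
  have hcoord : ∀ m i, ContinuousOn (fun t => y t m i) (Ici 0) := fun m i =>
    (State.contDiff_coord m i).continuous.comp_continuousOn hcont
  have hint : ∀ {F : Matrix (Fin N) (Fin N) ℝ → State N → ℝ}, (∀ l, ContDiff ℝ 1 (F (A l))) →
      ∀ t, 0 ≤ t → IntervalIntegrable (fun s => F (a s) (y s)) MeasureTheory.volume 0 t :=
    fun {F} hF t ht => htop.intervalIntegrable (G := fun B s => F B (y s)) ht fun l =>
      (hF l).continuous.comp_continuousOn (hcont.mono Icc_subset_Ici_self)
  have hftc : ∀ m i t, 0 ≤ t → IntervalIntegrable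
      (fun s => State.field b ρ l₁ l₂ (a s) (y s) m i) MeasureTheory.volume 0 t →
      ∫ s in (0 : ℝ)..t, State.field b ρ l₁ l₂ (a s) (y s) m i = y t m i - y 0 m i := by
    intro m i t ht hi
    refine intervalIntegral.integral_eq_sub_of_hasDeriv_right (f := fun t => y t m i) ?_ ?_ hi
    · rw [uIcc_of_le ht]
      exact (hcoord m i).mono Icc_subset_Ici_self
    · intro s hs
      rw [min_eq_left ht] at hs
      exact (hasDerivWithinAt_pi.1 (hasDerivWithinAt_pi.1 (hright s hs.1.le) m) i).mono
        Ioi_subset_Ici_self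
  -- Coordinates `2` and `3` start at zero, so the fundamental theorem of calculus identifies them
  -- with the integrals in the control law.
  have hstate : ∀ t, 0 ≤ t →
      stateOf ρ l₁ a (fun i t => y t 0 i) (fun i t => y t 1 i) t = y t := by
    intro t ht
    funext m i
    fin_cases m
    · rfl
    · rfl
    · have := hftc 2 i t ht (hint (F := fun B z => State.q ρ z i * State.r ρ B z i)
        (fun l => by fun_prop) t ht)
      rw [h2, Pi.zero_apply, sub_zero] at this
      exact this
    · have hi1 := hint (F := fun B z => State.q ρ z i ^ 2 * State.r ρ B z i ^ 2)
        (fun l => by fun_prop) t ht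
      have hi2 := hint (F := fun _ z => z 1 i ^ 2) (fun l => by fun_prop) t ht
      have := hftc 3 i t ht ((hi1.const_mul l₁).add hi2)
      rw [h3, Pi.zero_apply, sub_zero] at this
      refine Eq.trans ?_ this
      refine Eq.trans ?_ (intervalIntegral.integral_add (hi1.const_mul l₁) hi2).symm
      rw [intervalIntegral.integral_const_mul]
      rfl
  refine ⟨hcoord 0, hcoord 1, fun i t ht hτ => ?_, fun i t ht hτ => ?_⟩
  · exact hasDerivAt_pi.1 (hasDerivAt_pi.1 (hd t ht hτ) 0) i
  · rw [← u_stateOf, hstate t ht]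
    exact hasDerivAt_pi.1 (hasDerivAt_pi.1 (hd t ht hτ) 1) i

/-- The closed loop has a solution on `[0, ∞)` for all initial values. -/
theorem exists_isClosedLoopSolution (htop : SwitchingTopology A τ n a) (hb : ∀ i, b i ≠ 0)
    (hρ : 0 < ρ) (hl₁ : 0 < l₁) (hl₂ : 0 < l₂) (x₀ v₀ : Fin N → ℝ) :
    ∃ x v : Fin N → ℝ → ℝ, IsClosedLoopSolution b ρ l₁ l₂ τ a (Ici 0) x v ∧
      ∀ i, x i 0 = x₀ i ∧ v i 0 = v₀ i := by
  have ha : ∀ t, 0 ≤ t → ∃ l, a t = A l := fun t ht => htop.exists_eq ht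
  obtain ⟨K, hK0, hK⟩ := State.exists_bound_trajectory hb hρ hl₁ hl₂ ha ![x₀, v₀, 0, 0] rfl
  let χ : ContDiffBump (0 : State N) := ⟨K, K + 1, hK0, by linarith⟩
  have hsmooth : ∀ l, ContDiff ℝ 1 fun y => χ y • State.field b ρ l₁ l₂ (A l) y := fun l =>
    ContDiff.smul (by exact_mod_cast χ.contDiff (n := 1)) (State.contDiff_field b ρ l₁ l₂ (A l))
  obtain ⟨y, hy0, hcont, hright, hmid⟩ := exists_concatenation htop.strictMono htop.start
    (fun t ht => htop.exists_mem_Ico ht)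
    (f := fun j y => χ y • State.field b ρ l₁ l₂ (A (n j)) y)
    (fun j y => exists_integralCurve_of_hasCompactSupport (hsmooth (n j))
      χ.hasCompactSupport.smul_right (τ j) (τ (j + 1)) y) ![x₀, v₀, 0, 0]
  have hright' : ∀ t, 0 ≤ t →
      HasDerivWithinAt y (χ (y t) • State.field b ρ l₁ l₂ (a t) (y t)) (Ici t) t := by
    intro t ht
    obtain ⟨j, hj⟩ := htop.exists_mem_Ico ht
    rw [htop.active j t hj]
    exact hright j t hj
  have htraj : ∀ T, State.IsTrajectory b ρ l₁ l₂ a (fun t => χ (y t)) T y := fun T =>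
    ⟨hcont.mono Icc_subset_Ici_self, fun t ht => hright' t ht.1⟩
  -- The cut-off curve is a trajectory of speed `χ (y t)`, so the a priori bound keeps it in the
  -- ball of radius `K`, where the bump function is `1`.
  have hone : ∀ t, 0 ≤ t → χ (y t) = 1 := fun t ht => χ.one_of_mem_closedBall (by
    simpa using hK _ t y (fun _ => χ.nonneg) (fun _ => χ.le_one) (htraj t) hy0 t ⟨ht, le_rfl⟩)
  refine ⟨_, _, isClosedLoopSolution_of_field (y := y) htop hcont (by rw [hy0]; rfl)
    (by rw [hy0]; rfl) (fun t ht => ?_) (fun t ht hτ => ?_), fun i => ?_⟩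
  · have := hright' t ht
    rwa [hone t ht, one_smul] at this
  · obtain ⟨j, hj⟩ := htop.exists_mem_Ico ht
    have := hmid j t (SwitchingTopology.mem_Ioo_of_notMem_range hj hτ)
    rwa [hone t ht, one_smul, ← htop.active j t hj] at this
  · simp [hy0]

/-! ### Boundedness and consensus -/

theorem IsClosedLoopSolution.isTrajectory_of_Ici (htop : SwitchingTopology A τ n a)
    (h : IsClosedLoopSolution b ρ l₁ l₂ τ a (Ici 0) x v) (T : ℝ) :
    State.IsTrajectory b ρ l₁ l₂ a (fun _ => 1) T (stateOf ρ l₁ a x v) :=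
  (h.mono Ico_subset_Ici_self).isTrajectory htop (lt_add_one T)

theorem IsClosedLoopSolution.exists_bound_stateOf (htop : SwitchingTopology A τ n a)
    (hb : ∀ i, b i ≠ 0) (hρ : 0 < ρ) (hl₁ : 0 < l₁) (hl₂ : 0 < l₂)
    (h : IsClosedLoopSolution b ρ l₁ l₂ τ a (Ici 0) x v) :
    ∃ K : ℝ, ∀ t, 0 ≤ t → ‖stateOf ρ l₁ a x v t‖ ≤ K := by
  obtain ⟨K, -, hK⟩ := State.exists_bound_trajectory hb hρ hl₁ hl₂
    (fun t ht => htop.exists_eq ht) (stateOf ρ l₁ a x v 0) (by rw [stateOf_zero]; rfl)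
  exact ⟨K, fun t ht => hK _ t _ (fun _ => zero_le_one) (fun _ => le_rfl)
    (h.isTrajectory_of_Ici htop t) rfl t ⟨ht, le_rfl⟩⟩

/-- A continuous function of the topology and a bounded state is bounded. -/
theorem SwitchingTopology.exists_bound {E : Type*} [NormedAddCommGroup E]
    (htop : SwitchingTopology A τ n a)
    {y : ℝ → State N} {K : ℝ} (hK : ∀ t, 0 ≤ t → ‖y t‖ ≤ K)
    {F : Matrix (Fin N) (Fin N) ℝ → State N → E} (hF : ∀ l, Continuous (F (A l))) :
    ∃ C, ∀ t, 0 ≤ t → ‖F (a t) (y t)‖ ≤ C := by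
  choose B hB using fun l => (isCompact_closedBall (0 : State N) K).exists_bound_of_continuousOn
    (hF l).continuousOn
  obtain ⟨C, hC⟩ := (Set.finite_range B).bddAbove
  refine ⟨C, fun t ht => ?_⟩
  obtain ⟨l, hl⟩ := htop.exists_eq ht
  rw [hl]
  exact (hB l _ (by simpa using hK t ht)).trans (hC ⟨l, rfl⟩)

theorem IsClosedLoopSolution.exists_lipschitz (htop : SwitchingTopology A τ n a)
    (h : IsClosedLoopSolution b ρ l₁ l₂ τ a (Ici 0) x v) {K : ℝ}
    (hK : ∀ t, 0 ≤ t → ‖stateOf ρ l₁ a x v t‖ ≤ K) :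
    ∃ B : ℝ, ∀ s t, 0 ≤ s → 0 ≤ t →
      ‖stateOf ρ l₁ a x v s - stateOf ρ l₁ a x v t‖ ≤ B * |s - t| := by
  obtain ⟨B, hB⟩ := htop.exists_bound hK (F := State.field b ρ l₁ l₂)
    fun l => (State.contDiff_field b ρ l₁ l₂ (A l)).continuous
  have key : ∀ s t, 0 ≤ s → s ≤ t →
      ‖stateOf ρ l₁ a x v t - stateOf ρ l₁ a x v s‖ ≤ B * (t - s) := by
    intro s t hs hst
    have htr := h.isTrajectory_of_Ici htop t
    exact norm_image_sub_le_of_norm_deriv_right_le_segment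
      (f' := fun t => State.field b ρ l₁ l₂ (a t) (stateOf ρ l₁ a x v t))
      (htr.continuousOn.mono (Icc_subset_Icc_left hs))
      (fun r hr => by simpa using htr.deriv r ⟨hs.trans hr.1, hr.2⟩)
      (fun r hr => hB r (hs.trans hr.1)) t ⟨hst, le_rfl⟩
  refine ⟨B, fun s t hs ht => ?_⟩
  rcases le_total s t with hst | hst
  · rw [norm_sub_rev, abs_sub_comm, abs_of_nonneg (sub_nonneg.2 hst)]
    exact key s t hs hst
  · rw [abs_of_nonneg (sub_nonneg.2 hst)]
    exact key t s ht hst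

/-- Along closed-loop solutions, `qᵢ rᵢ` and `vᵢ` vanish asymptotically. -/
theorem IsClosedLoopSolution.tendsto_zero (htop : SwitchingTopology A τ n a)
    (hl₁ : 0 < l₁) (h : IsClosedLoopSolution b ρ l₁ l₂ τ a (Ici 0) x v) {K : ℝ}
    (hK : ∀ t, 0 ≤ t → ‖stateOf ρ l₁ a x v t‖ ≤ K) (i : Fin N) :
    Tendsto (fun t => q ρ x v i t * r ρ a x v i t) atTop (𝓝 0) ∧ Tendsto (v i) atTop (𝓝 0) := by
  -- `F` is the derivative of the last state coordinate, which is thus a bounded primitive; each of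
  -- its two terms is dominated by `F`.
  let F (B : Matrix (Fin N) (Fin N) ℝ) (y : State N) : ℝ :=
    l₁ * (State.q ρ y i ^ 2 * State.r ρ B y i ^ 2) + y 1 i ^ 2
  have hF : ∀ B, ContDiff ℝ 1 (F B) := fun B => by fun_prop
  have hF0 : ∀ B y, 0 ≤ F B y := fun B y => by positivity
  obtain ⟨B, hB⟩ := h.exists_lipschitz htop hK
  choose L hL using fun l => (hF (A l)).contDiffOn.exists_lipschitzOnWith one_ne_zero
    (convex_closedBall (0 : State N) K) (isCompact_closedBall _ _)
  obtain ⟨L', hL'⟩ := (Set.finite_range L).bddAbove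
  obtain ⟨τmin, hτmin, hdwell⟩ := htop.dwell
  have key : Tendsto (fun t => F (a t) (stateOf ρ l₁ a x v t)) atTop (𝓝 0) := by
    refine tendsto_zero_of_bounded_primitive (P := fun t => stateOf ρ l₁ a x v t 3 i)
      (C := K) (L := L' * B) hτmin hdwell
      (fun t ht => htop.exists_mem_Ico ht) htop.nonneg (fun t ht => ?_) (fun t ht => ?_)
      (fun t _ => hF0 _ _) (fun t ht => ?_) (fun j s hs t ht => ?_)
    · have h1 := (h.isTrajectory_of_Ici htop (t + 1)).continuousOn_comp
        (State.contDiff_coord 3 i)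
      refine (h1 t ⟨ht, by linarith⟩).mono_of_mem_nhdsWithin ?_
      rw [mem_nhdsWithin]
      exact ⟨Iio (t + 1), isOpen_Iio, by simp, fun s hs => ⟨hs.2, (show s < t + 1 from hs.1).le⟩⟩
    · have h1 := (h.isTrajectory_of_Ici htop (t + 1)).deriv_coord (t := t) ⟨ht, by linarith⟩ 3 i
      rw [one_mul] at h1
      exact h1
    · exact (le_abs_self _).trans (((norm_le_pi_norm _ i).trans
        (norm_le_pi_norm (stateOf ρ l₁ a x v t) 3)).trans (hK t ht))
    · have hs0 := (htop.nonneg j).trans hs.1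
      have ht0 := (htop.nonneg j).trans ht.1
      rw [htop.active j s hs, htop.active j t ht]
      have h1 := ((hL (n j)).weaken (hL' ⟨n j, rfl⟩)).dist_le_mul _
        (by simpa using hK s hs0) _ (by simpa using hK t ht0)
      rw [Real.dist_eq, dist_eq_norm] at h1
      rw [mul_assoc]
      exact h1.trans (by gcongr; exact hB s t hs0 ht0)
  have hsq : ∀ {g : ℝ → ℝ} {c : ℝ}, 0 < c →
      (∀ t, c * g t ^ 2 ≤ F (a t) (stateOf ρ l₁ a x v t)) → Tendsto g atTop (𝓝 0) := by
    intro g c hc hg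
    have h1 : Tendsto (fun t => c * g t ^ 2) atTop (𝓝 0) :=
      squeeze_zero (fun t => by positivity) hg key
    have h2 : Tendsto (fun t => g t ^ 2) atTop (𝓝 0) := by
      simpa [hc.ne'] using h1.const_mul c⁻¹
    rw [tendsto_zero_iff_abs_tendsto_zero]
    have h3 := h2.sqrt
    simpa [Function.comp_def, Real.sqrt_sq_eq_abs] using h3
  constructor
  · refine hsq hl₁ fun t => ?_
    change _ ≤ l₁ * (q ρ x v i t ^ 2 * r ρ a x v i t ^ 2) + v i t ^ 2
    rw [mul_pow]
    linarith [sq_nonneg (v i t)]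
  · refine hsq one_pos fun t => ?_
    change _ ≤ l₁ * (q ρ x v i t ^ 2 * r ρ a x v i t ^ 2) + v i t ^ 2
    have : 0 ≤ l₁ * (q ρ x v i t ^ 2 * r ρ a x v i t ^ 2) := by positivity
    linarith

/-- The positions of closed-loop solutions reach consensus. -/
theorem IsClosedLoopSolution.tendsto_sub (htop : SwitchingTopology A τ n a) (hρ : 0 < ρ)
    (hl₁ : 0 < l₁) (h : IsClosedLoopSolution b ρ l₁ l₂ τ a (Ici 0) x v) {K : ℝ}
    (hK : ∀ t, 0 ≤ t → ‖stateOf ρ l₁ a x v t‖ ≤ K) (i k : Fin N) :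
    Tendsto (fun t => x i t - x k t) atTop (𝓝 0) := by
  refine htop.joint.tendsto_sub (fun l S hS i hi k hk => ?_) i k
  obtain ⟨C, hC⟩ := htop.exists_bound hK (F := fun _ y => State.q ρ y) fun _ =>
    continuous_pi fun i => (State.contDiff_q ρ i).continuous
  obtain ⟨T, D, hT, hD, hact⟩ := htop.exists_active l
  rw [Metric.tendsto_atTop]
  intro ε hε
  -- At an activation time `s`, the errors `ε₁` for `q_i - q_k` and `ε₂` for each of `v_i`, `v_k`
  -- add up to at most `ρ ε / 2`, so `|x_i - x_k| < ε / 2`. Going back from `s` to `t` costs at most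
  -- `ε₂ D ≤ ε / 8` per agent.
  set ε₁ := ρ * ε / 4 with hε₁
  set ε₂ := min (ρ * ε / 8) (ε / (8 * D)) with hε₂
  have hε₁0 : 0 < ε₁ := by positivity
  have hε₂0 : 0 < ε₂ := by positivity
  obtain ⟨δ, hδ, hnear⟩ := exists_pos_forall_abs_sub_lt (htop.weights_nonneg l) hS hi hk C hε₁0
  have hev : ∀ᶠ t in atTop, ∀ j, |q ρ x v j t * r ρ a x v j t| < δ ∧ |v j t| < ε₂ := by
    refine eventually_all.2 fun j => ?_
    obtain ⟨h1, h2⟩ := h.tendsto_zero htop hl₁ hK j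
    have h1' := Metric.tendsto_nhds.1 h1 δ hδ
    have h2' := Metric.tendsto_nhds.1 h2 ε₂ hε₂0
    filter_upwards [h1', h2'] with t ht1 ht2
    simpa [Real.dist_eq] using And.intro ht1 ht2
  obtain ⟨T', hT'⟩ := eventually_atTop.1 hev
  refine ⟨max T T', fun t ht => ?_⟩
  have htT : T ≤ t := (le_max_left _ _).trans ht
  have htT' : T' ≤ t := (le_max_right _ _).trans ht
  obtain ⟨s, hts, hsD, hs⟩ := hact t htT
  have ht0 := hT.trans htT
  have hs0 := ht0.trans hts
  have hqs : |q ρ x v i s - q ρ x v k s| < ε₁ := by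
    refine hnear (State.q ρ (stateOf ρ l₁ a x v s)) (hC s hs0) fun j => ?_
    rw [← hs, ← State.r_eq_laplacian]
    exact (hT' s (htT'.trans hts) j).1.le
  have hx : ∀ j, |x j s - x j t| ≤ ε₂ * D := by
    intro j
    have htr := h.isTrajectory_of_Ici htop s
    have := norm_image_sub_le_of_norm_deriv_right_le_segment (f := x j) (f' := v j) (C := ε₂)
      (a := t) (b := s) ((htr.continuousOn_comp (State.contDiff_coord 0 j)).mono
        (Icc_subset_Icc_left ht0))
      (fun r hr => (htr.deriv_coord ⟨ht0.trans hr.1, hr.2⟩ 0 j).congr_deriv (one_mul _))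
      (fun r hr => (hT' r (htT'.trans hr.1) j).2.le) s ⟨hts, le_rfl⟩
    exact this.trans (by gcongr; linarith)
  have hvi := (hT' s (htT'.trans hts) i).2
  have hvk := (hT' s (htT'.trans hts) k).2
  have hb1 : ε₂ ≤ ρ * ε / 8 := min_le_left _ _
  have hb2 : ε₂ * D ≤ ε / 8 := by
    have : ε₂ * (8 * D) ≤ ε := (le_div_iff₀ (by positivity)).1 (min_le_right _ _)
    linarith
  have hs' : |x i s - x k s| < ε / 2 := by
    have h1 : ρ * (x i s - x k s) = (q ρ x v i s - q ρ x v k s) - v i s + v k s := by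
      simp only [q]; ring
    have h2 : ρ * |x i s - x k s| < ρ * (ε / 2) := by
      rw [← abs_of_pos hρ, ← abs_mul, abs_of_pos hρ, h1]
      rw [abs_lt] at hqs hvi hvk ⊢
      constructor <;> linarith
    exact lt_of_mul_lt_mul_left h2 hρ.le
  have hxi := hx i
  have hxk := hx k
  rw [Real.dist_eq, sub_zero]
  rw [abs_lt] at hs' ⊢
  rw [abs_le] at hxi hxk
  constructor <;> linarith

/-- The states and inputs of closed-loop solutions are bounded. -/
theorem exists_bound_of_stateOf (htop : SwitchingTopology A τ n a)
    {K : ℝ} (hK : ∀ t, 0 ≤ t → ‖stateOf ρ l₁ a x v t‖ ≤ K) (i : Fin N) :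
    ∃ C : ℝ, ∀ t, 0 ≤ t → |x i t| ≤ C ∧ |v i t| ≤ C ∧ |u ρ l₁ l₂ a x v i t| ≤ C := by
  obtain ⟨C, hC⟩ := htop.exists_bound hK (F := fun B y => State.u ρ l₁ l₂ B y i) fun l =>
    (State.contDiff_u ρ l₁ l₂ (A l) i).continuous
  have hcoord : ∀ m t, 0 ≤ t → |stateOf ρ l₁ a x v t m i| ≤ K := fun m t ht =>
    ((norm_le_pi_norm _ i).trans (norm_le_pi_norm (stateOf ρ l₁ a x v t) m)).trans (hK t ht)
  refine ⟨max K C, fun t ht => ⟨(hcoord 0 t ht).trans (le_max_left _ _),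
    (hcoord 1 t ht).trans (le_max_left _ _), ?_⟩⟩
  rw [← u_stateOf]
  exact (hC t ht).trans (le_max_right _ _)

end

end ConsensusPI

theorem theorem2 {N M : ℕ} (b : Fin N → ℝ) (hb : ∀ i, b i ≠ 0)
    (A : Fin M → Matrix (Fin N) (Fin N) ℝ) (τ : ℕ → ℝ) (n : ℕ → Fin M)
    (a : ℝ → Matrix (Fin N) (Fin N) ℝ)
    (htop : ConsensusPI.SwitchingTopology A τ n a)
    (ρ l₁ l₂ : ℝ) (hρ : 0 < ρ) (hl₁ : 0 < l₁) (hl₂ : 0 < l₂) :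
    -- for all initial data the closed loop has a solution on `[0, ∞)`
    (∀ x₀ v₀ : Fin N → ℝ, ∃ x v : Fin N → ℝ → ℝ,
      ConsensusPI.IsClosedLoopSolution b ρ l₁ l₂ τ a (Ici 0) x v ∧
      ∀ i, x i 0 = x₀ i ∧ v i 0 = v₀ i) ∧
    -- solutions are unique on every interval `[0, T)`
    (∀ T : ℝ, 0 < T → ∀ x v x' v' : Fin N → ℝ → ℝ,
      ConsensusPI.IsClosedLoopSolution b ρ l₁ l₂ τ a (Ico 0 T) x v →
      ConsensusPI.IsClosedLoopSolution b ρ l₁ l₂ τ a (Ico 0 T) x' v' →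
      (∀ i, x i 0 = x' i 0 ∧ v i 0 = v' i 0) →
      ∀ i, ∀ t ∈ Ico 0 T, x i t = x' i t ∧ v i t = v' i t) ∧
    -- every solution is bounded and reaches consensus
    (∀ x v : Fin N → ℝ → ℝ,
      ConsensusPI.IsClosedLoopSolution b ρ l₁ l₂ τ a (Ici 0) x v →
      (∀ i, ∃ C : ℝ, ∀ t : ℝ, 0 ≤ t →
        |x i t| ≤ C ∧ |v i t| ≤ C ∧ |ConsensusPI.u ρ l₁ l₂ a x v i t| ≤ C) ∧
      (∀ i k, Tendsto (fun t => x i t - x k t) atTop (𝓝 0)) ∧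
      (∀ i k, Tendsto (fun t => v i t - v k t) atTop (𝓝 0)) ∧
      ∀ i, Tendsto (v i) atTop (𝓝 0)) := by
  refine ⟨ConsensusPI.exists_isClosedLoopSolution htop hb hρ hl₁ hl₂,
    fun T _ x v x' v' h h' h0 i t ht => h.unique htop h' h0 i ht, fun x v h => ?_⟩
  obtain ⟨K, hK⟩ := h.exists_bound_stateOf htop hb hρ hl₁ hl₂
  have hv := fun i => (h.tendsto_zero htop hl₁ hK i).2
  exact ⟨ConsensusPI.exists_bound_of_stateOf htop hK, h.tendsto_sub htop hρ hl₁ hK,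
    fun i k => by simpa using (hv i).sub (hv k), hv⟩
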